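/- Let $a,b,s\in\mathbb{R}$ with $s\neq 0$; all functions and scalars are real, and $\mathbb N=\{0,1,2,\dots\}$. Let $H^1_{(1)}(0,1)=\{f\in H^1(0,1) : f(1)=0\}$ with inner product $\int_0^1 f_1'f_2'\,dx$, and let $\mathcal{H}^1=H^1_{(1)}(0,1)\times H^1(0,1)$ be the Hilbert space with inner product $$\langle (f_1,g_1),(f_2,g_2)\rangle=\int_0^1\left(f_1'f_2'+g_1g_2+g_1'g_2'\right)dx .$$ Put $\Delta=\{(n,m)\in\mathbb{N}^2 : 4(b-a)=(4m^2-(2n+1)^2)\pi^2\}$, $\Delta_1=\{n : \exists m,\ (n,m)\in\Delta\}$, $\Delta_2=\{m : \exists n,\ (n,m)\in\Delta\}$, $\lambda_{1,n}=a-(n+\tfrac12)^2\pi^2$, $\lambda_{2,m}=b-m^2\pi^2$, $\mu_0=1$ and $\mu_m=\sqrt2$ for $m\ge1$. For $n,m\ge0$ define the following pairs of functions on $(0,1)$. * $\varphi_{1,n}=\left(\sqrt2\cos((n+\tfrac12)\pi x),\,0\right)$ and $\varphi_{2,m}=\left(\varphi_{2,m}^1,\ \mu_m\cos(m\pi x)\right)$,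 where - if $m\in\Delta_2$ and $k$ is the unique integer with $(k,m)\in\Delta$, then $\varphi_{2,m}^1(x)=\frac{s\mu_m}{(k+1/2)\pi}(1-x)\sin((k+\tfrac12)\pi x)$; - if $m\notin\Delta_2$ and $b-a=m^2\pi^2$, then $\varphi_{2,m}^1(x)=s\mu_m(-1+x)$; - if $m\notin\Delta_2$ and $b-a\ne m^2\pi^2$, then $\varphi_{2,m}^1(x)=-\frac{s\mu_m}{r_m\cosh(r_m)}\sinh(r_m(1-x))$, where $r_m\in\mathbb{C}$ is either of the two square roots of $\lambda_{2,m}-a$ (this function is real-valued). * $\psi_{2,m}=\left(0,\ \mu_m\cos(m\pi x)\right)$ and $\psi_{1,n}=\left(\sqrt2\cos((n+\tfrac12)\pi x),\,\psi_{1,n}^2\right)$, where - if $n\notin\Delta_1$, then $\psi_{1,n}^2(x)=-\frac{\sqrt2 s}{r_n^*\sinh(r_n^*)}\cosh(r_n^*(1-x))$, where $r_n^*\in\mathbb{C}$ is either of the two square roots of $\lambda_{1,n}-b$ (this function is real-valued); - if $n\in\Delta_1$ and the unique integer $k$ with $(n,k)\in\Delta$ is $k=0$, then $\psi_{1,n}^2(x)=-s\sqrt2\left(\frac13+\frac1{(2n+1)^2\pi^2}\right)+\sqrt2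 s x-\frac{\sqrt2}{2}s x^2$; - if $n\in\Delta_1$ and this $k$ is $\ge1$, then $\psi_{1,n}^2(x)=\frac{\sqrt2 s}{k\pi}(1-x)\sin(k\pi x)-\frac{2s}{\pi^2}\left(\frac1{(2n+1)^2}+\frac1{4k^2}\right)\sqrt2\cos(k\pi x)$. Then each of the two families $$\left\{\tfrac{1}{(n+1/2)\pi}\varphi_{1,n}\right\}_{n\ge0}\cup\left\{\tfrac{1}{\sqrt{1+m^2\pi^2}}\varphi_{2,m}\right\}_{m\ge0},\qquad \left\{\tfrac{1}{(n+1/2)\pi}\psi_{1,n}\right\}_{n\ge0}\cup\left\{\tfrac{1}{\sqrt{1+m^2\pi^2}}\psi_{2,m}\right\}_{m\ge0}$$ is contained in $\mathcal{H}^1$ and is a Riesz basis of $\mathcal{H}^1$, that is, the image of a Hilbert (complete orthonormal) basis of $\mathcal{H}^1$ under a bounded linear bijection of $\mathcal{H}^1$ with bounded inverse. -/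

import Mathlib

namespace HeatCascade

open MeasureTheory Set Filter
open scoped ContDiff

/-! ### The Sobolev spaces on the interval `(0,1)` (real-valued functions) -/

/-- Lebesgue measure on `(0,1)`. -/
noncomputable abbrev unitMeasure : Measure ℝ := volume.restrict (Ioo (0 : ℝ) 1)

/-- The real Hilbert space `L²(0,1)`. -/
noncomputable abbrev L2 : Type := Lp ℝ 2 unitMeasure

/-- Test functions: smooth functions with compact support contained in `(0,1)`. -/
def IsTest (φ : ℝ → ℝ) : Prop :=
  ContDiff ℝ ∞ φ ∧ HasCompactSupport φ ∧ tsupport φ ⊆ Ioo (0 : ℝ) 1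

/-- `g ∈ L²(0,1)` is the weak derivative of `f ∈ L²(0,1)`. -/
def HasWeakDeriv (f g : L2) : Prop :=
  ∀ φ : ℝ → ℝ, IsTest φ →
    ∫ x in Ioo (0 : ℝ) 1, f x * deriv φ x = - ∫ x in Ioo (0 : ℝ) 1, g x * φ x

theorem IsTest.memLp {φ : ℝ → ℝ} (h : IsTest φ) : MemLp φ 2 unitMeasure :=
  (h.1.continuous.memLp_of_hasCompactSupport h.2.1).restrict _

theorem IsTest.memLp_deriv {φ : ℝ → ℝ} (h : IsTest φ) : MemLp (deriv φ) 2 unitMeasure :=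
  ((h.1.continuous_deriv (by simp)).memLp_of_hasCompactSupport h.2.1.deriv).restrict _

theorem integrable_mul_of_memLp (f : L2) {φ : ℝ → ℝ} (h : MemLp φ 2 unitMeasure) :
    Integrable (fun x => f x * φ x) unitMeasure :=
  (Lp.memLp f).integrable_mul h

theorem integral_add_mul (f g : L2) {φ : ℝ → ℝ} (h : MemLp φ 2 unitMeasure) :
    ∫ x in Ioo (0 : ℝ) 1, (f + g : L2) x * φ x =
      (∫ x in Ioo (0 : ℝ) 1, f x * φ x) + ∫ x in Ioo (0 : ℝ) 1, g x * φ x := by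
  rw [← integral_add (integrable_mul_of_memLp f h) (integrable_mul_of_memLp g h)]
  refine integral_congr_ae ?_
  filter_upwards [Lp.coeFn_add f g] with x hx
  rw [hx, Pi.add_apply, add_mul]

theorem integral_smul_mul (c : ℝ) (f : L2) (φ : ℝ → ℝ) :
    ∫ x in Ioo (0 : ℝ) 1, (c • f : L2) x * φ x =
      c * ∫ x in Ioo (0 : ℝ) 1, f x * φ x := by
  rw [← integral_const_mul]
  refine integral_congr_ae ?_
  filter_upwards [Lp.coeFn_smul c f] with x hx
  rw [hx, Pi.smul_apply, smul_eq_mul, mul_assoc]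

theorem HasWeakDeriv.add {f₁ g₁ f₂ g₂ : L2} (h₁ : HasWeakDeriv f₁ g₁)
    (h₂ : HasWeakDeriv f₂ g₂) : HasWeakDeriv (f₁ + f₂) (g₁ + g₂) := by
  intro φ hφ
  rw [integral_add_mul _ _ hφ.memLp_deriv, integral_add_mul _ _ hφ.memLp, h₁ φ hφ, h₂ φ hφ]
  ring

theorem HasWeakDeriv.smul (c : ℝ) {f g : L2} (h : HasWeakDeriv f g) :
    HasWeakDeriv (c • f) (c • g) := by
  intro φ hφ
  rw [integral_smul_mul, integral_smul_mul, h φ hφ]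
  ring

theorem HasWeakDeriv.zero : HasWeakDeriv 0 0 := by
  simpa using HasWeakDeriv.smul 0 (f := 0) (g := 0) (by
    intro φ hφ
    have h : ∀ ψ : ℝ → ℝ, ∫ x in Ioo (0 : ℝ) 1, (0 : L2) x * ψ x = 0 := by
      intro ψ
      simpa using integral_smul_mul 0 (0 : L2) ψ
    rw [h, h, neg_zero])

/-- The fundamental lemma of the calculus of variations on `(0,1)`. -/
theorem eq_zero_of_integral_test {u : ℝ → ℝ} (hu : Integrable u unitMeasure)
    (h : ∀ φ, IsTest φ → ∫ x in Ioo (0 : ℝ) 1, u x * φ x = 0) : u =ᵐ[unitMeasure] 0 := by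
  have key := isOpen_Ioo.ae_eq_zero_of_integral_contDiff_smul_eq_zero (μ := volume)
    (IntegrableOn.locallyIntegrableOn hu) (by
    intro φ h1 h2 h3
    rw [← h φ ⟨h1, h2, h3⟩]
    rw [← integral_indicator measurableSet_Ioo]
    refine integral_congr_ae (Eventually.of_forall fun x => ?_)
    by_cases hx : x ∈ Ioo (0 : ℝ) 1
    · simp [hx, mul_comm]
    · have : φ x = 0 := image_eq_zero_of_notMem_tsupport fun hh => hx (h3 hh)
      simp only [indicator_of_notMem hx, this, zero_smul])
  rw [EventuallyEq, ae_restrict_iff' measurableSet_Ioo]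
  exact key

theorem L2.integrable (f : L2) : Integrable f unitMeasure :=
  (Lp.memLp f).integrable (by norm_num)

theorem HasWeakDeriv.unique {f g₁ g₂ : L2} (h₁ : HasWeakDeriv f g₁)
    (h₂ : HasWeakDeriv f g₂) : g₁ = g₂ := by
  have h := h₁.add (h₂.smul (-1))
  rw [← sub_eq_zero, Lp.eq_zero_iff_ae_eq_zero]
  refine eq_zero_of_integral_test (L2.integrable _) ?_
  intro φ hφ
  have := h φ hφ
  have e : g₁ - g₂ = g₁ + (-1 : ℝ) • g₂ := by rw [neg_one_smul, sub_eq_add_neg]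
  have e' : f + (-1 : ℝ) • f = (0 : ℝ) • f := by rw [neg_one_smul, zero_smul]; abel
  rw [e', integral_smul_mul, zero_mul] at this
  rw [e]
  linarith

theorem IsTest.integrable {φ : ℝ → ℝ} (h : IsTest φ) : Integrable φ unitMeasure :=
  (h.1.continuous.integrable_of_hasCompactSupport h.2.1).restrict

theorem IsTest.integral_eq {φ : ℝ → ℝ} (h : IsTest φ) :
    ∫ x in Ioo (0 : ℝ) 1, φ x = ∫ x, φ x := by
  refine setIntegral_eq_integral_of_forall_compl_eq_zero fun x hx => ?_
  exact image_eq_zero_of_notMem_tsupport fun hh => hx (h.2.2 hh)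

/-- A test function of integral zero is the derivative of a test function. -/
theorem IsTest.exists_primitive {θ : ℝ → ℝ} (h : IsTest θ)
    (h0 : ∫ x in Ioo (0 : ℝ) 1, θ x = 0) : ∃ ψ, IsTest ψ ∧ deriv ψ = θ := by
  have hcont : Continuous θ := h.1.continuous
  obtain ⟨p, q, hp, hq, hout⟩ : ∃ p q : ℝ, 0 < p ∧ q < 1 ∧ ∀ x, x ∉ Icc p q → θ x = 0 := by
    rcases (tsupport θ).eq_empty_or_nonempty with he | hne
    · refine ⟨1 / 2, 1 / 2, by norm_num, by norm_num, fun x _ => ?_⟩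
      exact image_eq_zero_of_notMem_tsupport (by simp [he])
    · obtain ⟨p, hp⟩ := IsCompact.exists_isLeast (s := tsupport θ) h.2.1 hne
      obtain ⟨q, hq⟩ := IsCompact.exists_isGreatest (s := tsupport θ) h.2.1 hne
      exact ⟨p, q, (h.2.2 hp.1).1, (h.2.2 hq.1).2, fun x hx =>
        image_eq_zero_of_notMem_tsupport fun hh => hx ⟨hp.2 hh, hq.2 hh⟩⟩
  have hd : ∀ x, HasDerivAt (fun y => ∫ t in (0 : ℝ)..y, θ t) (θ x) x := fun x =>
    intervalIntegral.integral_hasDerivAt_right (hcont.intervalIntegrable _ _)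
      hcont.stronglyMeasurable.stronglyMeasurableAtFilter hcont.continuousAt
  have hderiv : deriv (fun y => ∫ t in (0 : ℝ)..y, θ t) = θ := funext fun x => (hd x).deriv
  have h01 : ∫ t in (0 : ℝ)..1, θ t = 0 := by
    rw [intervalIntegral.integral_of_le zero_le_one, integral_Ioc_eq_integral_Ioo, h0]
  have hvan : ∀ x, x ∉ Icc p q → ∫ t in (0 : ℝ)..x, θ t = 0 := by
    intro x hx
    rcases lt_or_ge x p with hxp | hxp
    · refine (intervalIntegral.integral_congr (g := fun _ => 0) fun t ht => ?_).trans (by simp)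
      refine hout t fun hh => ?_
      rcases le_total 0 x with h1 | h1
      · rw [uIcc_of_le h1] at ht
        linarith [ht.2, hh.1]
      · rw [uIcc_of_ge h1] at ht
        linarith [ht.2, hh.1]
    · have hxq : q < x := not_le.1 fun hh => hx ⟨hxp, hh⟩
      rw [← intervalIntegral.integral_add_adjacent_intervals
        (hcont.intervalIntegrable 0 1) (hcont.intervalIntegrable 1 x), h01, zero_add]
      refine (intervalIntegral.integral_congr (g := fun _ => 0) fun t ht => ?_).trans (by simp)
      refine hout t fun hh => ?_
      rcases le_total 1 x with h1 | h1
      · rw [uIcc_of_le h1] at ht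
        linarith [ht.1, hh.2]
      · rw [uIcc_of_ge h1] at ht
        linarith [ht.1, hh.2]
  have hsub : tsupport (fun y => ∫ t in (0 : ℝ)..y, θ t) ⊆ Icc p q :=
    closure_minimal (fun x hx => by_contra fun hh => hx (hvan x hh)) isClosed_Icc
  refine ⟨_, ⟨?_, ?_, ?_⟩, hderiv⟩
  · rw [contDiff_infty_iff_deriv, hderiv]
    exact ⟨fun x => (hd x).differentiableAt, h.1⟩
  · exact isCompact_Icc.of_isClosed_subset (isClosed_tsupport _) hsub
  · exact hsub.trans fun x hx => ⟨hp.trans_le hx.1, hx.2.trans_lt hq⟩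

/-- A function on `(0,1)` with vanishing weak derivative is constant. -/
theorem HasWeakDeriv.ae_const {f : L2} (h : HasWeakDeriv f 0) :
    ∃ c : ℝ, f =ᵐ[unitMeasure] fun _ => c := by
  let B : ContDiffBump (1 / 2 : ℝ) := ⟨1 / 8, 1 / 4, by norm_num, by norm_num⟩
  let η : ℝ → ℝ := B.normed volume
  have hη : IsTest η := by
    refine ⟨B.contDiff_normed, B.hasCompactSupport_normed, ?_⟩
    rw [B.tsupport_normed_eq, Real.closedBall_eq_Icc]
    intro x hx
    simp only [B, mem_Icc] at hx
    constructor <;> linarith [hx.1, hx.2]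
  have hηint : ∫ x in Ioo (0 : ℝ) 1, η x = 1 := by
    rw [hη.integral_eq]
    exact B.integral_normed
  set c : ℝ := ∫ x in Ioo (0 : ℝ) 1, f x * η x with hc
  refine ⟨c, ?_⟩
  have key : ∀ φ, IsTest φ →
      ∫ x in Ioo (0 : ℝ) 1, f x * φ x = c * ∫ x in Ioo (0 : ℝ) 1, φ x := by
    intro φ hφ
    set I : ℝ := ∫ x in Ioo (0 : ℝ) 1, φ x with hI
    have hθ : IsTest (fun x => φ x - I * η x) := by
      refine ⟨hφ.1.sub (contDiff_const.mul hη.1), hφ.2.1.sub (hη.2.1.mul_left), ?_⟩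
      refine (tsupport_sub φ (fun x => I * η x)).trans (union_subset hφ.2.2 ?_)
      exact (tsupport_mul_subset_right (f := fun _ => I) (g := η)).trans hη.2.2
    obtain ⟨ψ, hψ, hd⟩ := hθ.exists_primitive (by
      rw [integral_sub hφ.integrable (hη.integrable.const_mul I), integral_const_mul, hηint]
      simp [hI])
    have h0 := h ψ hψ
    have hz : ∫ x in Ioo (0 : ℝ) 1, (0 : L2) x * ψ x = 0 := by
      simpa using integral_smul_mul 0 (0 : L2) ψ
    rw [hz, neg_zero, hd] at h0
    have e : ∀ x, f x * (φ x - I * η x) = f x * φ x - I * (f x * η x) := fun x => by ring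
    simp only [e] at h0
    rw [integral_sub (integrable_mul_of_memLp f hφ.memLp)
      ((integrable_mul_of_memLp f hη.memLp).const_mul I), integral_const_mul, ← hc] at h0
    linarith
  have hae : (fun x => f x - c) =ᵐ[unitMeasure] 0 := by
    refine eq_zero_of_integral_test ((L2.integrable f).sub (integrable_const c)) ?_
    intro φ hφ
    have e : ∀ x, (f x - c) * φ x = f x * φ x - c * φ x := fun x => by ring
    simp only [e]
    rw [integral_sub (integrable_mul_of_memLp f hφ.memLp) (hφ.integrable.const_mul c),
      integral_const_mul, key φ hφ, sub_self]
  filter_upwards [hae] with x hx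
  simpa [sub_eq_zero] using hx

/-- `H¹(0,1)`, as a set of elements of `L²(0,1)`: those with a weak derivative in `L²(0,1)`. -/
def H1Submodule : Submodule ℝ L2 where
  carrier := {f | ∃ g : L2, HasWeakDeriv f g}
  add_mem' := by
    rintro f₁ f₂ ⟨g₁, h₁⟩ ⟨g₂, h₂⟩
    exact ⟨g₁ + g₂, h₁.add h₂⟩
  zero_mem' := ⟨0, HasWeakDeriv.zero⟩
  smul_mem' := by
    rintro c f ⟨g, h⟩
    exact ⟨c • g, h.smul c⟩

/-- `H¹₍₁₎(0,1)`, as a set of elements of `L²(0,1)`: the `f ∈ H¹(0,1)` with `f(1) = 0`. The value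
at `1` is that of the continuous representative of `f` on `[0,1]`. -/
def H1RightSubmodule : Submodule ℝ L2 where
  carrier := {f | f ∈ H1Submodule ∧ ∃ F : ℝ → ℝ,
    ContinuousOn F (Icc 0 1) ∧ f =ᵐ[unitMeasure] F ∧ F 1 = 0}
  add_mem' := by
    rintro f₁ f₂ ⟨h₁, F₁, c₁, e₁, z₁⟩ ⟨h₂, F₂, c₂, e₂, z₂⟩
    refine ⟨H1Submodule.add_mem h₁ h₂, F₁ + F₂, c₁.add c₂, ?_, by simp [z₁, z₂]⟩
    exact (Lp.coeFn_add f₁ f₂).trans (e₁.add e₂)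
  zero_mem' := ⟨H1Submodule.zero_mem, 0, continuousOn_const, Lp.coeFn_zero _ _ _, rfl⟩
  smul_mem' := by
    rintro c f ⟨h, F, k, e, z⟩
    refine ⟨H1Submodule.smul_mem c h, c • F, k.const_smul c, ?_, by simp [z]⟩
    exact (Lp.coeFn_smul c f).trans (e.const_smul c)

/-- The weak derivative `f ↦ f'` from `H¹(0,1)` to `L²(0,1)`. -/
noncomputable def weakDeriv : H1Submodule →ₗ[ℝ] L2 where
  toFun f := f.2.choose
  map_add' f g :=
    (f + g).2.choose_spec.unique (f.2.choose_spec.add g.2.choose_spec)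
  map_smul' c f := (c • f).2.choose_spec.unique (f.2.choose_spec.smul c)

theorem hasWeakDeriv_weakDeriv (f : H1Submodule) : HasWeakDeriv (f : L2) (weakDeriv f) :=
  f.2.choose_spec

/-- The space `H¹(0,1)`, with its own norm (not that of `L²(0,1)`), given below. -/
def H1 : Type := H1Submodule

/-- The space `H¹₍₁₎(0,1)`, with its own norm (not that of `L²(0,1)`), given below. -/
def H1Right : Type := H1RightSubmodule

noncomputable instance : AddCommGroup H1 := inferInstanceAs (AddCommGroup H1Submodule)
noncomputable instance : Module ℝ H1 := inferInstanceAs (Module ℝ H1Submodule)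
noncomputable instance : AddCommGroup H1Right := inferInstanceAs (AddCommGroup H1RightSubmodule)
noncomputable instance : Module ℝ H1Right := inferInstanceAs (Module ℝ H1RightSubmodule)

/-- The underlying element of `L²(0,1)`. -/
noncomputable def H1.val : H1 →ₗ[ℝ] L2 := H1Submodule.subtype

/-- The weak derivative on `H¹(0,1)`. -/
noncomputable def H1.der : H1 →ₗ[ℝ] L2 := weakDeriv

/-- The underlying element of `L²(0,1)`. -/
noncomputable def H1Right.val : H1Right →ₗ[ℝ] L2 := H1RightSubmodule.subtype

/-- The weak derivative on `H¹₍₁₎(0,1)`. -/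
noncomputable def H1Right.der : H1Right →ₗ[ℝ] L2 :=
  weakDeriv.comp (Submodule.inclusion (fun _ hf => hf.1 : H1RightSubmodule ≤ H1Submodule))

theorem H1Right.eq_zero_of_der_eq_zero (f : H1Right) (h : H1Right.der f = 0) : f = 0 := by
  obtain ⟨hf, F, hF, hfF, hF1⟩ := f.2
  have hw : HasWeakDeriv (H1Right.val f) (H1Right.der f) := hasWeakDeriv_weakDeriv ⟨_, hf⟩
  rw [h] at hw
  obtain ⟨c, hc⟩ := hw.ae_const
  have hFc : F =ᵐ[unitMeasure] fun _ => c := hfF.symm.trans hc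
  have hIoo : EqOn F (fun _ => c) (Ioo 0 1) :=
    Measure.eqOn_open_of_ae_eq hFc isOpen_Ioo (hF.mono Ioo_subset_Icc_self) continuousOn_const
  have hIcc : EqOn F (fun _ => c) (Icc 0 1) :=
    hIoo.of_subset_closure hF continuousOn_const Ioo_subset_Icc_self
      (by rw [closure_Ioo zero_ne_one])
  have hc0 : c = 0 := by rw [← hF1]; exact (hIcc (right_mem_Icc.2 zero_le_one)).symm
  refine Subtype.ext ?_
  change H1Right.val f = 0
  rw [Lp.eq_zero_iff_ae_eq_zero]
  filter_upwards [hc] with x hx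
  rw [hx, hc0, Pi.zero_apply]

/-- The inner product `∫₀¹ (g₁ g₂ + g₁' g₂') dx` of `H¹(0,1)`. -/
@[reducible]
noncomputable def H1.innerCore : InnerProductSpace.Core ℝ H1 where
  inner g₁ g₂ := inner ℝ (H1.val g₁) (H1.val g₂) + inner ℝ (H1.der g₁) (H1.der g₂)
  conj_inner_symm f g := by simp [real_inner_comm]
  re_inner_nonneg f := add_nonneg real_inner_self_nonneg real_inner_self_nonneg
  add_left f g h := by simp only [map_add, inner_add_left]; ring
  smul_left f g r := by simp only [map_smul, real_inner_smul_left, conj_trivial]; ring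
  definite f hf := by
    have h1 : (0 : ℝ) ≤ inner ℝ (H1.val f) (H1.val f) := real_inner_self_nonneg
    have h2 : (0 : ℝ) ≤ inner ℝ (H1.der f) (H1.der f) := real_inner_self_nonneg
    have h3 : inner ℝ (H1.val f) (H1.val f) = (0 : ℝ) := by linarith
    exact Subtype.ext (inner_self_eq_zero.1 h3)

noncomputable instance : NormedAddCommGroup H1 := H1.innerCore.toNormedAddCommGroup
noncomputable instance : InnerProductSpace ℝ H1 := InnerProductSpace.ofCore H1.innerCore.toCore

/-- The inner product `∫₀¹ f₁' f₂' dx` of `H¹₍₁₎(0,1)`. -/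
@[reducible]
noncomputable def H1Right.innerCore : InnerProductSpace.Core ℝ H1Right where
  inner f₁ f₂ := inner ℝ (H1Right.der f₁) (H1Right.der f₂)
  conj_inner_symm f g := by simp [real_inner_comm]
  re_inner_nonneg f := real_inner_self_nonneg (x := H1Right.der f)
  add_left f g h := by simp only [map_add, inner_add_left]
  smul_left f g r := by simp only [map_smul, real_inner_smul_left, conj_trivial]
  definite f hf := H1Right.eq_zero_of_der_eq_zero f (inner_self_eq_zero.1 hf)

noncomputable instance : NormedAddCommGroup H1Right := H1Right.innerCore.toNormedAddCommGroup
noncomputable instance : InnerProductSpace ℝ H1Right :=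
  InnerProductSpace.ofCore H1Right.innerCore.toCore

/-- The Hilbert space `H¹₍₁₎(0,1) × H¹(0,1)`; `WithLp 2` selects the inner product that is the sum
of the inner products of the two factors. -/
abbrev HSpace : Type := WithLp 2 (H1Right × H1)

theorem HSpace.inner_eq (u v : HSpace) :
    inner ℝ u v = (∫ x in Ioo (0 : ℝ) 1, H1Right.der u.fst x * H1Right.der v.fst x) +
      ((∫ x in Ioo (0 : ℝ) 1, H1.val u.snd x * H1.val v.snd x) +
        ∫ x in Ioo (0 : ℝ) 1, H1.der u.snd x * H1.der v.snd x) := by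
  have key : ∀ f g : L2, inner ℝ f g = ∫ x in Ioo (0 : ℝ) 1, f x * g x := by
    intro f g
    rw [L2.inner_def]
    simp [mul_comm]
  rw [← key, ← key, ← key, WithLp.prod_inner_apply]
  rfl

/-- The element `u` of `H¹₍₁₎(0,1) × H¹(0,1)` is the (class of the) pair of functions `p`. -/
def HSpace.IsClassOf (u : HSpace) (p : (ℝ → ℝ) × (ℝ → ℝ)) : Prop :=
  H1Right.val u.fst =ᵐ[unitMeasure] p.1 ∧ H1.val u.snd =ᵐ[unitMeasure] p.2

/-- A Riesz basis of a Hilbert space: the image of a Hilbert (complete orthonormal) basis under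
a bounded linear operator with bounded inverse. -/
def IsRieszBasis {ι E : Type*} [NormedAddCommGroup E] [InnerProductSpace ℝ E] (v : ι → E) : Prop :=
  ∃ (e : HilbertBasis ι ℝ E) (T : E ≃L[ℝ] E), ∀ i, T (e i) = v i

/-! ### The two families of functions -/

section Families

open Real

/-- `Δ(a,b) = {(n,m) ∈ ℕ² : 4(b-a) = (4m² - (2n+1)²)π²}`. -/
def Delta (a b : ℝ) : Set (ℕ × ℕ) :=
  {p | 4 * (b - a) = (4 * (p.2 : ℝ) ^ 2 - (2 * (p.1 : ℝ) + 1) ^ 2) * π ^ 2}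

def Delta₁ (a b : ℝ) : Set ℕ := {n | ∃ m, (n, m) ∈ Delta a b}

def Delta₂ (a b : ℝ) : Set ℕ := {m | ∃ n, (n, m) ∈ Delta a b}

/-- The integer chosen below as `Exists.choose` is unique. -/
theorem Delta.left_unique {a b : ℝ} {n n' m : ℕ} (h : (n, m) ∈ Delta a b)
    (h' : (n', m) ∈ Delta a b) : n = n' := by
  simp only [Delta, mem_ofPred_eq] at h h'
  have h1 := mul_right_cancel₀ (pow_ne_zero 2 pi_ne_zero) (h.symm.trans h')
  have h2 : (2 * (n : ℝ) + 1) ^ 2 = (2 * (n' : ℝ) + 1) ^ 2 := by linarith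
  have h3 := (sq_eq_sq₀ (by positivity) (by positivity)).1 h2
  exact_mod_cast (show (n : ℝ) = n' by linarith)

/-- The integer chosen below as `Exists.choose` is unique. -/
theorem Delta.right_unique {a b : ℝ} {n m m' : ℕ} (h : (n, m) ∈ Delta a b)
    (h' : (n, m') ∈ Delta a b) : m = m' := by
  simp only [Delta, mem_ofPred_eq] at h h'
  have h1 := mul_right_cancel₀ (pow_ne_zero 2 pi_ne_zero) (h.symm.trans h')
  have h2 : (m : ℝ) ^ 2 = (m' : ℝ) ^ 2 := by linarith
  exact_mod_cast (sq_eq_sq₀ (by positivity) (by positivity)).1 h2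

noncomputable def lambda₁ (a : ℝ) (n : ℕ) : ℝ := a - ((n : ℝ) + 1 / 2) ^ 2 * π ^ 2

noncomputable def lambda₂ (b : ℝ) (m : ℕ) : ℝ := b - (m : ℝ) ^ 2 * π ^ 2

noncomputable def mu (m : ℕ) : ℝ := if m = 0 then 1 else √2

/-- `φ_{1,n} = (√2 cos((n+1/2)πx), 0)`. -/
noncomputable def phi₁ (n : ℕ) : (ℝ → ℝ) × (ℝ → ℝ) :=
  (fun x => √2 * cos (((n : ℝ) + 1 / 2) * π * x), fun _ => 0)

/-- The common second component of `φ_{2,m}` and `ψ_{2,m}`. -/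
noncomputable def cosMode (m : ℕ) : ℝ → ℝ :=
  fun x => if m = 0 then 1 else √2 * cos ((m : ℝ) * π * x)

open scoped Classical in
/-- The first component of `φ_{2,m}`. Here `r` stands for a complex square root of `λ_{2,m} - a`;
the expression whose real part is taken is then real. -/
noncomputable def phi₂Fst (a b s : ℝ) (r : ℂ) (m : ℕ) : ℝ → ℝ := fun x =>
  if h : m ∈ Delta₂ a b then
    s * mu m / (((h.choose : ℝ) + 1 / 2) * π) * (1 - x) * sin (((h.choose : ℝ) + 1 / 2) * π * x)
  else if b - a = (m : ℝ) ^ 2 * π ^ 2 then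
    s * mu m * (-1 + x)
  else
    (-((s * mu m : ℝ) : ℂ) / (r * Complex.cosh r) * Complex.sinh (r * (1 - (x : ℂ)))).re

noncomputable def phi₂ (a b s : ℝ) (r : ℂ) (m : ℕ) : (ℝ → ℝ) × (ℝ → ℝ) :=
  (phi₂Fst a b s r m, cosMode m)

open scoped Classical in
/-- The second component of `ψ_{1,n}`. Here `r` stands for a complex square root of `λ_{1,n} - b`;
the expression whose real part is taken is then real. -/
noncomputable def psi₁Snd (a b s : ℝ) (r : ℂ) (n : ℕ) : ℝ → ℝ := fun x =>
  if h : n ∈ Delta₁ a b then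
    if h.choose = 0 then
      -s * √2 * (1 / 3 + 1 / ((2 * (n : ℝ) + 1) ^ 2 * π ^ 2)) + √2 * s * x - √2 / 2 * s * x ^ 2
    else
      √2 * s / ((h.choose : ℝ) * π) * (1 - x) * sin ((h.choose : ℝ) * π * x) +
        -(2 * s / π ^ 2) * (1 / (2 * (n : ℝ) + 1) ^ 2 + 1 / (4 * (h.choose : ℝ) ^ 2)) *
          √2 * cos ((h.choose : ℝ) * π * x)
  else
    (-((√2 * s : ℝ) : ℂ) / (r * Complex.sinh r) * Complex.cosh (r * (1 - (x : ℂ)))).re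

noncomputable def psi₁ (a b s : ℝ) (r : ℂ) (n : ℕ) : (ℝ → ℝ) × (ℝ → ℝ) :=
  (fun x => √2 * cos (((n : ℝ) + 1 / 2) * π * x), psi₁Snd a b s r n)

/-- `ψ_{2,m} = (0, cosMode m)`. -/
noncomputable def psi₂ (m : ℕ) : (ℝ → ℝ) × (ℝ → ℝ) := (fun _ => 0, cosMode m)

theorem real_or_imaginary_of_sq {r : ℂ} {d : ℝ} (h : r ^ 2 = (d : ℂ)) :
    (∃ t : ℝ, r = t) ∨ ∃ t : ℝ, r = t * Complex.I := by
  have him := congrArg Complex.im h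
  simp only [sq, Complex.mul_im, Complex.ofReal_im] at him
  have : r.re = 0 ∨ r.im = 0 := by
    rcases mul_eq_zero.1 (show r.re * r.im = 0 by linarith) with h | h <;> simp [h]
  rcases this with h0 | h0
  · exact Or.inr ⟨r.im, by apply Complex.ext <;> simp [h0]⟩
  · exact Or.inl ⟨r.re, by apply Complex.ext <;> simp [h0]⟩

/-- Taking the real part in `phi₂Fst` changes nothing. -/
theorem phi₂Fst_real {r : ℂ} {d : ℝ} (h : r ^ 2 = (d : ℂ)) (c x : ℝ) :
    (-(c : ℂ) / (r * Complex.cosh r) * Complex.sinh (r * (1 - (x : ℂ)))).im = 0 := by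
  rcases real_or_imaginary_of_sq h with ⟨t, rfl⟩ | ⟨t, rfl⟩
  · have : -(c : ℂ) / ((t : ℂ) * Complex.cosh t) * Complex.sinh (t * (1 - (x : ℂ))) =
        ((-c / (t * Real.cosh t) * Real.sinh (t * (1 - x)) : ℝ) : ℂ) := by
      push_cast
      rfl
    rw [this, Complex.ofReal_im]
  · have e : (t : ℂ) * Complex.I * (1 - (x : ℂ)) = ((t * (1 - x) : ℝ) : ℂ) * Complex.I := by
      push_cast
      ring
    have : -(c : ℂ) / ((t : ℂ) * Complex.I * Real.cos t) *
        (Real.sin (t * (1 - x)) * Complex.I) =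
        ((-c / (t * Real.cos t) * Real.sin (t * (1 - x)) : ℝ) : ℂ) := by
      rw [mul_right_comm (t : ℂ), ← div_div, div_mul_eq_mul_div, mul_div_assoc,
        mul_div_cancel_right₀ _ Complex.I_ne_zero]
      push_cast
      rfl
    rw [e, Complex.cosh_mul_I, Complex.sinh_mul_I, ← Complex.ofReal_cos, ← Complex.ofReal_sin,
      this, Complex.ofReal_im]

/-- Taking the real part in `psi₁Snd` changes nothing. -/
theorem psi₁Snd_real {r : ℂ} {d : ℝ} (h : r ^ 2 = (d : ℂ)) (c x : ℝ) :
    (-(c : ℂ) / (r * Complex.sinh r) * Complex.cosh (r * (1 - (x : ℂ)))).im = 0 := by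
  rcases real_or_imaginary_of_sq h with ⟨t, rfl⟩ | ⟨t, rfl⟩
  · have : -(c : ℂ) / ((t : ℂ) * Complex.sinh t) * Complex.cosh (t * (1 - (x : ℂ))) =
        ((-c / (t * Real.sinh t) * Real.cosh (t * (1 - x)) : ℝ) : ℂ) := by
      push_cast
      rfl
    rw [this, Complex.ofReal_im]
  · have e : (t : ℂ) * Complex.I * (1 - (x : ℂ)) = ((t * (1 - x) : ℝ) : ℂ) * Complex.I := by
      push_cast
      ring
    have : -(c : ℂ) / ((t : ℂ) * Complex.I * (Real.sin t * Complex.I)) *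
        Real.cos (t * (1 - x)) =
        ((c / (t * Real.sin t) * Real.cos (t * (1 - x)) : ℝ) : ℂ) := by
      rw [mul_mul_mul_comm, Complex.I_mul_I, mul_neg_one, neg_div_neg_eq]
      push_cast
      rfl
    rw [e, Complex.cosh_mul_I, Complex.sinh_mul_I, ← Complex.ofReal_cos, ← Complex.ofReal_sin,
      this, Complex.ofReal_im]

/-- The rescaled family: `u n / ((n+1/2)π)` for the first half of the index set, and
`v m / √(1+m²π²)` for the second half. -/
noncomputable def rescaled (u v : ℕ → (ℝ → ℝ) × (ℝ → ℝ)) : ℕ ⊕ ℕ → (ℝ → ℝ) × (ℝ → ℝ)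
  | Sum.inl n => (1 / (((n : ℝ) + 1 / 2) * π)) • u n
  | Sum.inr m => (1 / √(1 + (m : ℝ) ^ 2 * π ^ 2)) • v m

end Families

end HeatCascade

/-! Each family is an orthonormal basis `e` plus a small perturbation `w` that maps one factor of
the product into the other. The vectors `(√2 cos((n+1/2)πx) / ((n+1/2)π), 0)` and `(0, μₘ cos(mπx) /
√(1+m²π²))` form a Hilbert basis of `HSpace` (`productBasis`). The family `φ` differs from it only
by first components added to the second half, the family `ψ` only by second components added to the
first half.

If `∑ ‖w i‖²` converges, there is a bounded operator `K` with `K (e i) = w i` (`exists_clm_hasSum`).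
Since `w` takes values in the factor whose basis vectors are unperturbed, `K² = 0`, so `1 + K` has
the bounded inverse `1 - K` and carries `e i` to `e i + w i` (`IsRieszBasis.of_add`).

Square-summability is needed only for large indices. There the formulas with `cosh r` or `sinh r`
apply, `r = it` is imaginary with `|t|` within distance one of `mπ`, respectively `(n+1/2)π`, and
the denominator `cos t`, respectively `sin t`, stays at least `1/2` in absolute value. The
perturbing functions are therefore bounded in `H¹`, and the rescaling contributes a factor `O(1/m)`.
For the finitely many other indices it is enough that the function is `C¹` and, in the first
component, vanishes at `1`. -/

namespace HeatCascade

open MeasureTheory Set Filter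
open scoped ContDiff

/-! ### Nilpotent square-summable perturbations of a Hilbert basis -/

section Perturbation

variable {ι E F : Type*} [NormedAddCommGroup E] [InnerProductSpace ℝ E] [NormedAddCommGroup F]
  [NormedSpace ℝ F] [CompleteSpace F]

/-- Square-summable vectors are the images of a Hilbert basis under a bounded operator. -/
theorem exists_clm_hasSum (e : HilbertBasis ι ℝ E) (w : ι → F)
    (hw : Summable fun i => ‖w i‖ ^ 2) :
    ∃ K : E →L[ℝ] F, ∀ x, HasSum (fun i => e.repr x i • w i) (K x) := by
  have hsq : ∀ x, HasSum (fun i => ‖e.repr x i‖ ^ 2) (‖x‖ ^ 2) := by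
    intro x
    have h := lp.hasSum_norm (p := 2) (by norm_num) (e.repr x)
    rw [e.repr.norm_map] at h
    simpa using h
  -- Cauchy–Schwarz with Parseval gives absolute convergence and the operator bound at once.
  have hcs : ∀ x, Summable (fun i => ‖e.repr x i‖ * ‖w i‖) ∧
      ∑' i, ‖e.repr x i‖ * ‖w i‖ ≤ ‖x‖ * √(∑' i, ‖w i‖ ^ 2) := by
    intro x
    have h := Real.summable_and_inner_le_Lp_mul_Lq_tsum_of_nonneg
      Real.HolderConjugate.two_two (fun i => norm_nonneg (e.repr x i)) (fun i => norm_nonneg (w i))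
      (by simpa using (hsq x).summable) (by simpa using hw)
    refine ⟨h.1, h.2.trans_eq ?_⟩
    simp only [Real.rpow_ofNat, (hsq x).tsum_eq]
    rw [← Real.sqrt_eq_rpow, ← Real.sqrt_eq_rpow, Real.sqrt_sq (norm_nonneg x)]
  have hs : ∀ x, Summable (fun i => e.repr x i • w i) := fun x =>
    Summable.of_norm (by simpa [norm_smul] using (hcs x).1)
  let K : E →ₗ[ℝ] F :=
    { toFun := fun x => ∑' i, e.repr x i • w i
      map_add' := fun x y => by
        rw [← (hs x).tsum_add (hs y)]
        simp [add_smul]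
      map_smul' := fun c x => by
        rw [RingHom.id_apply, ← (hs x).tsum_const_smul c]
        simp [mul_smul] }
  refine ⟨K.mkContinuous (√(∑' i, ‖w i‖ ^ 2)) fun x => ?_, fun x => (hs x).hasSum⟩
  calc ‖∑' i, e.repr x i • w i‖ ≤ ∑' i, ‖e.repr x i • w i‖ :=
        norm_tsum_le_tsum_norm (by simpa [norm_smul] using (hcs x).1)
    _ = ∑' i, ‖e.repr x i‖ * ‖w i‖ := by simp only [norm_smul]
    _ ≤ √(∑' i, ‖w i‖ ^ 2) * ‖x‖ := by rw [mul_comm]; exact (hcs x).2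

/-- A Hilbert basis perturbed by square-summable vectors `w i`, such that `w` is orthogonal to all
basis vectors `e i` with `w i ≠ 0`, is a Riesz basis. -/
theorem IsRieszBasis.of_add [CompleteSpace E] (e : HilbertBasis ι ℝ E) (w : ι → E)
    (hw : Summable fun i => ‖w i‖ ^ 2)
    (horth : ∀ i j, inner ℝ (e i) (w j) = 0 ∨ w i = 0) :
    IsRieszBasis fun i => e i + w i := by
  classical
  obtain ⟨K, hK⟩ := exists_clm_hasSum e w hw
  have hKe : ∀ i, K (e i) = w i := by
    intro i
    refine (hK (e i)).unique ?_
    convert! hasSum_ite_eq i (w i) using 2 with j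
    rw [e.repr_self, lp.single_apply]
    by_cases h : j = i
    · subst h; simp
    · simp [h]
  -- In the expansion of `w j` only basis vectors with `w i = 0` have nonzero coefficients, and `K`
  -- kills those.
  have hKw : ∀ j, K (w j) = 0 := by
    intro j
    refine (hK (w j)).unique ?_
    convert! (hasSum_zero : HasSum (fun _ : ι => (0 : E)) 0) using 2 with i
    rw [e.repr_apply_apply]
    rcases horth i j with h | h <;> simp [h]
  have hKK : ∀ x, K (K x) = 0 := by
    intro x
    refine ((hK x).mapL K).unique ?_
    simp [hKw]
  -- `(1 + K)(1 - K) = 1 - K² = 1`.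
  refine ⟨e, ContinuousLinearEquiv.equivOfInverse (1 + K) (1 - K) (fun x => ?_) (fun x => ?_),
    fun i => ?_⟩
  · simp [hKK]
  · simp [hKK]
  · simp [hKe]

end Perturbation

/-! ### Completeness of the cosines and of the half-integer sines -/

section Completeness

open Real

theorem integrable_mul_continuous {u : ℝ → ℝ} (hu : Integrable u unitMeasure) {f : ℝ → ℝ}
    (hf : Continuous f) : Integrable (fun x => u x * f x) unitMeasure := by
  obtain ⟨C, hC⟩ := isCompact_Icc.exists_bound_of_continuousOn (hf.continuousOn (s := Icc 0 1))
  refine hu.mul_bdd (c := C) hf.aestronglyMeasurable ?_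
  exact (ae_restrict_iff' measurableSet_Ioo).2
    (Eventually.of_forall fun x hx => hC x (Ioo_subset_Icc_self hx))

/-- An integrable function on `(0,1)` whose moments against the powers of `cos (π x)` vanish is
zero. -/
theorem ae_eq_zero_of_integral_cos_pow {u : ℝ → ℝ} (hu : Integrable u unitMeasure)
    (h : ∀ n : ℕ, ∫ x in Ioo (0 : ℝ) 1, u x * cos (π * x) ^ n = 0) : u =ᵐ[unitMeasure] 0 := by
  refine eq_zero_of_integral_test hu fun φ hφ => ?_
  let c : C(Icc (0 : ℝ) 1, ℝ) := ⟨fun x => cos (π * x), by fun_prop⟩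
  have hpoly : ∀ p : Polynomial ℝ, ∫ x in Ioo (0 : ℝ) 1, u x * p.eval (cos (π * x)) = 0 := by
    intro p
    induction p using Polynomial.induction_on' with
    | add p q hp hq =>
      simp only [Polynomial.eval_add, mul_add]
      rw [integral_add (integrable_mul_continuous hu (by fun_prop))
        (integrable_mul_continuous hu (by fun_prop)), hp, hq, add_zero]
    | monomial n a =>
      simp only [Polynomial.eval_monomial, mul_left_comm _ a]
      rw [integral_const_mul, h, mul_zero]
  -- `cos` is injective on `[0,π]`, so the single generator `cos (π x)` separates points and
  -- Stone–Weierstrass applies.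
  have hsep : (Algebra.adjoin ℝ {c}).SeparatesPoints := by
    intro x y hxy
    refine ⟨c, ⟨c, Algebra.subset_adjoin rfl, rfl⟩, fun hc => hxy (Subtype.ext ?_)⟩
    have hmem : ∀ z : Icc (0 : ℝ) 1, π * (z : ℝ) ∈ Icc 0 π := fun z =>
      ⟨mul_nonneg pi_pos.le z.2.1, mul_le_of_le_one_right pi_pos.le z.2.2⟩
    exact mul_left_cancel₀ pi_ne_zero (injOn_cos (hmem x) (hmem y) hc)
  have hnorm : 0 ≤ ∫ x in Ioo (0 : ℝ) 1, ‖u x‖ := integral_nonneg fun _ => norm_nonneg _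
  have hle : ∀ ε > 0, |∫ x in Ioo (0 : ℝ) 1, u x * φ x| ≤ ε * ∫ x in Ioo (0 : ℝ) 1, ‖u x‖ := by
    intro ε hε
    obtain ⟨⟨g, hg⟩, hgε⟩ := ContinuousMap.exists_mem_subalgebra_near_continuous_of_separatesPoints
      _ hsep (fun x : Icc (0 : ℝ) 1 => φ x) (hφ.1.continuous.comp continuous_subtype_val) ε hε
    rw [Algebra.adjoin_singleton_eq_range_aeval] at hg
    obtain ⟨p, hp⟩ := hg
    have hgp : ∀ x : Icc (0 : ℝ) 1, g x = p.eval (cos (π * x)) := by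
      intro x
      rw [← hp]
      exact Polynomial.aeval_continuousMap_apply p c x
    have e : ∫ x in Ioo (0 : ℝ) 1, u x * φ x =
        ∫ x in Ioo (0 : ℝ) 1, u x * (φ x - p.eval (cos (π * x))) := by
      simp only [mul_sub]
      rw [integral_sub (integrable_mul_continuous hu hφ.1.continuous)
        (integrable_mul_continuous hu (by fun_prop)), hpoly, sub_zero]
    rw [e, ← integral_const_mul, ← Real.norm_eq_abs]
    refine norm_integral_le_of_norm_le (hu.norm.const_mul ε) ?_
    refine (ae_restrict_iff' measurableSet_Ioo).2 (Eventually.of_forall fun x hx => ?_)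
    have hx' := hgε ⟨x, Ioo_subset_Icc_self hx⟩
    simp only [hgp] at hx'
    rw [norm_mul, mul_comm ε, norm_sub_rev]
    gcongr
  by_contra hne
  have hpos : 0 < |∫ x in Ioo (0 : ℝ) 1, u x * φ x| := abs_pos.2 hne
  -- With this `ε` the bound is less than half of the left side; the `1 +` avoids division by zero.
  have h1 := hle (|∫ x in Ioo (0 : ℝ) 1, u x * φ x| /
    (2 * (1 + ∫ x in Ioo (0 : ℝ) 1, ‖u x‖))) (by positivity)
  rw [div_mul_eq_mul_div, le_div_iff₀ (by positivity)] at h1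
  nlinarith

/-- Completeness of the cosines on `(0,1)`. -/
theorem ae_eq_zero_of_integral_cos {u : ℝ → ℝ} (hu : Integrable u unitMeasure)
    (h : ∀ n : ℕ, ∫ x in Ioo (0 : ℝ) 1, u x * cos (n * π * x) = 0) : u =ᵐ[unitMeasure] 0 := by
  refine ae_eq_zero_of_integral_cos_pow hu fun n => ?_
  -- Powers of `cos (π x)` are reduced one at a time by the product formula. The frequency `k` stays
  -- general because each step shifts it to `k ± 1`; frequency `0` is separate because its lower
  -- neighbour is negative.
  have key : ∀ (n k : ℕ), ∫ x in Ioo (0 : ℝ) 1, u x * (cos (π * x) ^ n * cos (k * π * x)) = 0 := by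
    intro n
    induction n with
    | zero => simpa using h
    | succ n ih =>
      rintro (_ | k)
      · simpa [pow_succ] using ih 1
      · have e : ∀ x, u x * (cos (π * x) ^ (n + 1) * cos ((k + 1 : ℕ) * π * x)) =
            1 / 2 * (u x * (cos (π * x) ^ n * cos ((k + 2 : ℕ) * π * x))) +
              1 / 2 * (u x * (cos (π * x) ^ n * cos (k * π * x))) := by
          intro x
          have h1 : ((k + 2 : ℕ) : ℝ) * π * x = (k + 1 : ℕ) * π * x + π * x := by push_cast; ring
          have h2 : (k : ℝ) * π * x = (k + 1 : ℕ) * π * x - π * x := by push_cast; ring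
          rw [h1, h2, cos_add, cos_sub]
          ring
        simp only [e]
        rw [integral_add ((integrable_mul_continuous hu (by fun_prop)).const_mul _)
          ((integrable_mul_continuous hu (by fun_prop)).const_mul _), integral_const_mul,
          integral_const_mul, ih, ih]
        simp
  simpa using key n 0

/-- Completeness of the sines `sin ((n + 1/2) π x)` on `(0,1)`. -/
theorem ae_eq_zero_of_integral_sin {u : ℝ → ℝ} (hu : Integrable u unitMeasure)
    (h : ∀ n : ℕ, ∫ x in Ioo (0 : ℝ) 1, u x * sin (((n : ℝ) + 1 / 2) * π * x) = 0) :
    u =ᵐ[unitMeasure] 0 := by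
  -- Multiplying by `sin (πx/2)`, which is positive on `(0,1)`, reduces to the cosines: `sin (πx/2)
  -- cos (nπx)` is half a difference of half-integer sines.
  have key : (fun x => u x * sin (1 / 2 * π * x)) =ᵐ[unitMeasure] 0 := by
    refine ae_eq_zero_of_integral_cos (integrable_mul_continuous hu (by fun_prop)) ?_
    rintro (_ | n)
    · simpa using h 0
    · have e : ∀ x, u x * sin (1 / 2 * π * x) * cos ((n + 1 : ℕ) * π * x) =
          1 / 2 * (u x * sin (((n + 1 : ℕ) + 1 / 2) * π * x)) -
            1 / 2 * (u x * sin ((n + 1 / 2) * π * x)) := by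
        intro x
        have h1 : (((n + 1 : ℕ) : ℝ) + 1 / 2) * π * x =
          (n + 1 : ℕ) * π * x + 1 / 2 * π * x := by push_cast; ring
        have h2 : ((n : ℝ) + 1 / 2) * π * x =
          (n + 1 : ℕ) * π * x - 1 / 2 * π * x := by push_cast; ring
        rw [h1, h2, sin_add, sin_sub]
        ring
      simp only [e]
      rw [integral_sub ((integrable_mul_continuous hu (by fun_prop)).const_mul _)
          ((integrable_mul_continuous hu (by fun_prop)).const_mul _), integral_const_mul,
          integral_const_mul, h, h]
      simp
  filter_upwards [key, ae_restrict_mem measurableSet_Ioo] with x hx hx01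
  refine (mul_eq_zero.1 hx).resolve_right (ne_of_gt (sin_pos_of_pos_of_lt_pi ?_ ?_))
  · have := hx01.1; positivity
  · nlinarith [hx01.2, pi_pos]

end Completeness

/-! ### Primitives, integration by parts and completeness of the Sobolev spaces -/

section Sobolev

theorem IsTest.apply_zero {φ : ℝ → ℝ} (h : IsTest φ) : φ 0 = 0 :=
  image_eq_zero_of_notMem_tsupport fun hh => lt_irrefl _ (h.2.2 hh).1

theorem IsTest.apply_one {φ : ℝ → ℝ} (h : IsTest φ) : φ 1 = 0 :=
  image_eq_zero_of_notMem_tsupport fun hh => lt_irrefl _ (h.2.2 hh).2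

theorem IsTest.hasDerivAt {φ : ℝ → ℝ} (h : IsTest φ) (x : ℝ) : HasDerivAt φ (deriv φ x) x :=
  (h.1.differentiable (by simp) x).hasDerivAt

theorem IsTest.continuous_deriv {φ : ℝ → ℝ} (h : IsTest φ) : Continuous (deriv φ) :=
  h.1.continuous_deriv (by simp)

theorem setIntegral_Ioo_eq (f : ℝ → ℝ) : ∫ x in Ioo (0 : ℝ) 1, f x = ∫ x in (0 : ℝ)..1, f x := by
  rw [intervalIntegral.integral_of_le zero_le_one, integral_Ioc_eq_integral_Ioo]

theorem memLp_of_continuousOn {F : ℝ → ℝ} (hF : ContinuousOn F (Icc 0 1)) :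
    MemLp F 2 unitMeasure := by
  obtain ⟨C, hC⟩ := isCompact_Icc.exists_bound_of_continuousOn hF
  refine MemLp.of_bound ((hF.mono Ioo_subset_Icc_self).aestronglyMeasurable measurableSet_Ioo) C ?_
  exact (ae_restrict_iff' measurableSet_Ioo).2
    (Eventually.of_forall fun x hx => hC x (Ioo_subset_Icc_self hx))

theorem L2.intervalIntegrable (h : L2) : IntervalIntegrable h volume 0 1 :=
  (intervalIntegrable_iff_integrableOn_Ioo_of_le zero_le_one).2 (L2.integrable h)

theorem integral_toLp_mul {F : ℝ → ℝ} (hF : MemLp F 2 unitMeasure) (φ : ℝ → ℝ) :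
    ∫ x in Ioo (0 : ℝ) 1, hF.toLp F x * φ x = ∫ x in Ioo (0 : ℝ) 1, F x * φ x := by
  refine integral_congr_ae ?_
  filter_upwards [hF.coeFn_toLp] with x hx
  rw [hx]

/-- Every `h ∈ L²(0,1)` has a continuous primitive vanishing at `1`, which satisfies the
integration by parts formula. -/
theorem L2.exists_primitive (h : L2) : ∃ (F : ℝ → ℝ) (hF : ContinuousOn F (Icc 0 1)),
    F 1 = 0 ∧ (∀ φ φ' : ℝ → ℝ, (∀ x, HasDerivAt φ (φ' x) x) → Continuous φ' →
      ∫ x in Ioo (0 : ℝ) 1, F x * φ' x = -(F 0 * φ 0) - ∫ x in Ioo (0 : ℝ) 1, h x * φ x) ∧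
    HasWeakDeriv ((memLp_of_continuousOn hF).toLp F) h := by
  have hint := h.intervalIntegrable
  have hG := hint.absolutelyContinuousOnInterval_intervalIntegral (c := 1) (by simp)
  have hF : ContinuousOn (fun x => ∫ t in (1 : ℝ)..x, h t) (Icc 0 1) := by
    simpa using hG.continuousOn
  have hparts : ∀ φ φ' : ℝ → ℝ, (∀ x, HasDerivAt φ (φ' x) x) → Continuous φ' →
      ∫ x in Ioo (0 : ℝ) 1, (∫ t in (1 : ℝ)..x, h t) * φ' x =
        -((∫ t in (1 : ℝ)..0, h t) * φ 0) - ∫ x in Ioo (0 : ℝ) 1, h x * φ x := by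
    intro φ φ' hφ hφ'
    have hd : deriv φ = φ' := funext fun x => (hφ x).deriv
    have hφac : AbsolutelyContinuousOnInterval φ 0 1 := by
      refine ContDiffOn.absolutelyContinuousOnInterval (ContDiff.contDiffOn ?_)
      rw [contDiff_one_iff_deriv, hd]
      exact ⟨fun x => (hφ x).differentiableAt, hφ'⟩
    -- The primitive is only absolutely continuous; its derivative is `h` almost everywhere by
    -- Lebesgue differentiation.
    have key := hG.integral_mul_deriv_eq_deriv_mul hφac
    rw [setIntegral_Ioo_eq, setIntegral_Ioo_eq, ← hd, key, intervalIntegral.integral_same, zero_mul,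
      zero_sub]
    congr 1
    refine intervalIntegral.integral_congr_ae ?_
    filter_upwards [hint.ae_hasDerivAt_integral] with x hx hx01
    rw [(hx (uIoc_subset_uIcc hx01) 1 (by simp)).deriv]
  refine ⟨_, hF, by simp, hparts, fun φ hφ => ?_⟩
  rw [integral_toLp_mul, hparts φ (deriv φ) hφ.hasDerivAt hφ.continuous_deriv, hφ.apply_zero]
  simp

theorem H1.hasWeakDeriv (u : H1) : HasWeakDeriv (H1.val u) (H1.der u) :=
  hasWeakDeriv_weakDeriv u

theorem H1Right.hasWeakDeriv (u : H1Right) : HasWeakDeriv (H1Right.val u) (H1Right.der u) :=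
  hasWeakDeriv_weakDeriv ⟨_, u.2.1⟩

theorem H1Right.der_surjective : Function.Surjective H1Right.der := by
  intro h
  obtain ⟨F, hF, hF1, -, hw⟩ := h.exists_primitive
  have hm := memLp_of_continuousOn hF
  let u : H1Right := ⟨hm.toLp F, ⟨h, hw⟩, F, hF, hm.coeFn_toLp, hF1⟩
  exact ⟨u, (H1Right.hasWeakDeriv u).unique hw⟩

/-- Integration by parts against a `C¹` function vanishing at both end points. -/
theorem H1.integral_mul_deriv (u : H1) {φ φ' : ℝ → ℝ} (hφ : ∀ x, HasDerivAt φ (φ' x) x)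
    (hφ' : Continuous φ') (h0 : φ 0 = 0) (h1 : φ 1 = 0) :
    ∫ x in Ioo (0 : ℝ) 1, H1.val u x * φ' x = -∫ x in Ioo (0 : ℝ) 1, H1.der u x * φ x := by
  obtain ⟨F, hF, hF1, hparts, hw⟩ := (H1.der u).exists_primitive
  have hm := memLp_of_continuousOn hF
  have hdiff := (H1.hasWeakDeriv u).add (hw.smul (-1))
  rw [neg_one_smul, neg_one_smul, add_neg_cancel] at hdiff
  -- `u` is the primitive of its weak derivative plus a constant `c`, which contributes `c (φ 1 - φ
  -- 0) = 0`. This extends the weak identity to test functions without compact support in `(0,1)`,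
  -- such as sines.
  obtain ⟨c, hc⟩ := hdiff.ae_const
  have e : (fun x => H1.val u x * φ' x) =ᵐ[unitMeasure] fun x => F x * φ' x + c * φ' x := by
    filter_upwards [hc, Lp.coeFn_add (H1.val u) (-hm.toLp F), Lp.coeFn_neg (hm.toLp F),
      hm.coeFn_toLp] with x e1 e2 e3 e4
    rw [e2, Pi.add_apply, e3, Pi.neg_apply, e4] at e1
    rw [← add_mul, ← e1]
    ring
  have hφm := memLp_of_continuousOn (hφ'.continuousOn (s := Icc 0 1))
  rw [integral_congr_ae e, integral_add (f := fun x => F x * φ' x) (hm.integrable_mul hφm)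
    ((hφm.integrable (by norm_num)).const_mul c), hparts φ φ' hφ hφ', integral_const_mul,
    setIntegral_Ioo_eq φ', intervalIntegral.integral_eq_sub_of_hasDerivAt (fun x _ => hφ x)
      (hφ'.intervalIntegrable _ _), h0, h1]
  simp

theorem H1.exists_of_hasDerivAt {F F' : ℝ → ℝ} (hF : ∀ x, HasDerivAt F (F' x) x)
    (hF' : Continuous F') :
    ∃ u : H1, H1.val u =ᵐ[unitMeasure] F ∧ H1.der u =ᵐ[unitMeasure] F' := by
  have hc : Continuous F := continuous_iff_continuousAt.2 fun x => (hF x).continuousAt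
  have hm := memLp_of_continuousOn (hc.continuousOn (s := Icc 0 1))
  have hm' := memLp_of_continuousOn (hF'.continuousOn (s := Icc 0 1))
  have hw : HasWeakDeriv (hm.toLp F) (hm'.toLp F') := by
    intro φ hφ
    rw [integral_toLp_mul, integral_toLp_mul, setIntegral_Ioo_eq, setIntegral_Ioo_eq,
      intervalIntegral.integral_mul_deriv_eq_deriv_mul (fun x _ => hF x)
        (fun x _ => hφ.hasDerivAt x) (hF'.intervalIntegrable _ _)
        (hφ.continuous_deriv.intervalIntegrable _ _), hφ.apply_zero, hφ.apply_one]
    simp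
  let u : H1 := ⟨hm.toLp F, hm'.toLp F', hw⟩
  refine ⟨u, hm.coeFn_toLp, ?_⟩
  rw [show H1.der u = hm'.toLp F' from (H1.hasWeakDeriv u).unique hw]
  exact hm'.coeFn_toLp

theorem H1Right.exists_of_hasDerivAt {F F' : ℝ → ℝ} (hF : ∀ x, HasDerivAt F (F' x) x)
    (hF' : Continuous F') (h1 : F 1 = 0) :
    ∃ u : H1Right, H1Right.val u =ᵐ[unitMeasure] F ∧ H1Right.der u =ᵐ[unitMeasure] F' := by
  obtain ⟨v, hv, hv'⟩ := H1.exists_of_hasDerivAt hF hF'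
  have hc : Continuous F := continuous_iff_continuousAt.2 fun x => (hF x).continuousAt
  exact ⟨⟨v.1, v.2, F, hc.continuousOn, hv, h1⟩, hv, hv'⟩

theorem L2.real_inner_eq (f g : L2) : inner ℝ f g = ∫ x in Ioo (0 : ℝ) 1, f x * g x := by
  rw [MeasureTheory.L2.inner_def]
  simp [mul_comm]

theorem L2.real_inner_eq_of_ae {f g : L2} {F G : ℝ → ℝ} (hf : f =ᵐ[unitMeasure] F)
    (hg : g =ᵐ[unitMeasure] G) : inner ℝ f g = ∫ x in (0 : ℝ)..1, F x * G x := by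
  rw [L2.real_inner_eq, ← setIntegral_Ioo_eq]
  refine integral_congr_ae ?_
  filter_upwards [hf, hg] with x h1 h2
  rw [h1, h2]

/-- The interval has measure one, so a uniform bound also bounds the `L²` norm. -/
theorem L2.norm_sq_le {f : L2} {F : ℝ → ℝ} (hf : f =ᵐ[unitMeasure] F) {C : ℝ}
    (hC : ∀ x ∈ Icc (0 : ℝ) 1, |F x| ≤ C) : ‖f‖ ^ 2 ≤ C ^ 2 := by
  have h := Lp.norm_le_of_ae_bound (f := f) (C := C)
    ((abs_nonneg _).trans (hC 0 (left_mem_Icc.2 zero_le_one))) (by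
      filter_upwards [hf, ae_restrict_mem measurableSet_Ioo] with x hx hx01
      rw [hx]
      exact hC x (Ioo_subset_Icc_self hx01))
  simp [measureUnivNNReal] at h
  gcongr

theorem H1.inner_def (u v : H1) :
    inner ℝ u v = inner ℝ (H1.val u) (H1.val v) + inner ℝ (H1.der u) (H1.der v) := rfl

theorem H1Right.inner_def (u v : H1Right) :
    inner ℝ u v = inner ℝ (H1Right.der u) (H1Right.der v) := rfl

theorem H1.norm_sq (u : H1) : ‖u‖ ^ 2 = ‖H1.val u‖ ^ 2 + ‖H1.der u‖ ^ 2 := by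
  rw [← real_inner_self_eq_norm_sq, H1.inner_def, real_inner_self_eq_norm_sq,
    real_inner_self_eq_norm_sq]

theorem H1Right.norm_sq (u : H1Right) : ‖u‖ ^ 2 = ‖H1Right.der u‖ ^ 2 := by
  rw [← real_inner_self_eq_norm_sq, H1Right.inner_def, real_inner_self_eq_norm_sq]

/-- Differentiation is a surjective isometry onto `L²(0,1)`. -/
instance : CompleteSpace H1Right := by
  let e := LinearIsometryEquiv.ofSurjective
    (H1Right.der.isometryOfInner fun u v => (H1Right.inner_def u v).symm) H1Right.der_surjective
  exact e.toIsometryEquiv.completeSpace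

/-- For a fixed test function both sides are inner products with fixed `L²` elements, hence
continuous in the pair. -/
theorem isClosed_hasWeakDeriv :
    IsClosed {p : WithLp 2 (L2 × L2) | HasWeakDeriv p.fst p.snd} := by
  simp only [HasWeakDeriv, ofPred_forall]
  refine isClosed_iInter fun φ => isClosed_iInter fun hφ => ?_
  have e : ∀ (f : L2) {ψ : ℝ → ℝ} (hψ : MemLp ψ 2 unitMeasure),
      ∫ x in Ioo (0 : ℝ) 1, f x * ψ x = inner ℝ f (hψ.toLp ψ) := by
    intro f ψ hψ
    rw [L2.real_inner_eq]
    refine integral_congr_ae ?_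
    filter_upwards [hψ.coeFn_toLp] with x hx
    rw [hx]
  simp only [e _ hφ.memLp, e _ hφ.memLp_deriv]
  exact isClosed_eq (by fun_prop) (by fun_prop)

/-- The map `u ↦ (u, u')` is an isometry onto the closed graph of the weak derivative. -/
instance : CompleteSpace H1 := by
  let j : H1 →ₗ[ℝ] WithLp 2 (L2 × L2) :=
    (WithLp.linearEquiv 2 ℝ (L2 × L2)).symm.toLinearMap ∘ₗ (H1.val.prod H1.der)
  let J := j.isometryOfInner fun u v => by
    rw [WithLp.prod_inner_apply]
    rfl
  refine J.isometry.isUniformInducing.completeSpace ?_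
  have hr : range J = {p : WithLp 2 (L2 × L2) | HasWeakDeriv p.fst p.snd} := by
    ext p
    constructor
    · rintro ⟨u, rfl⟩
      exact u.hasWeakDeriv
    · intro hp
      let u : H1 := ⟨p.fst, p.snd, hp⟩
      refine ⟨u, ?_⟩
      have h2 : H1.der u = p.snd := u.hasWeakDeriv.unique hp
      change WithLp.toLp 2 (H1.val u, H1.der u) = p
      rw [h2]
      rfl
  rw [hr]
  exact isClosed_hasWeakDeriv.isComplete

end Sobolev

/-! ### The trigonometric Hilbert basis -/

section TrigonometricBasis

open Real

theorem integral_cos_int_mul_pi (j : ℤ) :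
    ∫ x in (0 : ℝ)..1, cos (j * π * x) = if j = 0 then 1 else 0 := by
  split_ifs with h
  · simp [h]
  · have hj : (j : ℝ) * π ≠ 0 := mul_ne_zero (Int.cast_ne_zero.2 h) pi_ne_zero
    rw [intervalIntegral.integral_comp_mul_left (fun y => cos y) hj, integral_cos]
    simp [sin_int_mul_pi]

theorem integral_cos_mul_cos (α β : ℝ) (j l : ℤ) (hj : α - β = j * π) (hl : α + β = l * π) :
    ∫ x in (0 : ℝ)..1, cos (α * x) * cos (β * x) =
      ((if j = 0 then 1 else 0) + if l = 0 then 1 else 0) / 2 := by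
  have e : ∀ x, cos (α * x) * cos (β * x) = (cos (j * π * x) + cos (l * π * x)) / 2 := by
    intro x
    rw [← hj, ← hl, sub_mul, add_mul, cos_sub, cos_add]
    ring
  simp only [e]
  rw [intervalIntegral.integral_div, intervalIntegral.integral_add, integral_cos_int_mul_pi,
    integral_cos_int_mul_pi] <;>
  exact Continuous.intervalIntegrable (by fun_prop) _ _

theorem integral_sin_mul_sin (α β : ℝ) (j l : ℤ) (hj : α - β = j * π) (hl : α + β = l * π) :
    ∫ x in (0 : ℝ)..1, sin (α * x) * sin (β * x) =
      ((if j = 0 then 1 else 0) - if l = 0 then 1 else 0) / 2 := by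
  have e : ∀ x, sin (α * x) * sin (β * x) = (cos (j * π * x) - cos (l * π * x)) / 2 := by
    intro x
    rw [← hj, ← hl, sub_mul, add_mul, cos_sub, cos_add]
    ring
  simp only [e]
  rw [intervalIntegral.integral_div, intervalIntegral.integral_sub, integral_cos_int_mul_pi,
    integral_cos_int_mul_pi] <;>
  exact Continuous.intervalIntegrable (by fun_prop) _ _

theorem cosMode_eq (m : ℕ) (x : ℝ) : cosMode m x = mu m * cos (m * π * x) := by
  rcases eq_or_ne m 0 with rfl | h <;> simp [cosMode, mu, *]

theorem mu_pos (m : ℕ) : 0 < mu m := by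
  unfold mu
  split_ifs <;> positivity

theorem hasDerivAt_cos_mul (c α x : ℝ) :
    HasDerivAt (fun x => c * cos (α * x)) (-(c * α) * sin (α * x)) x := by
  have h := (((hasDerivAt_id x).const_mul α).cos).const_mul c
  simp only [id, mul_one] at h
  exact h.congr_deriv (by ring)

theorem hasDerivAt_sin_mul (c α x : ℝ) :
    HasDerivAt (fun x => c * sin (α * x)) (c * α * cos (α * x)) x := by
  have h := (((hasDerivAt_id x).const_mul α).sin).const_mul c
  simp only [id, mul_one] at h
  exact h.congr_deriv (by ring)

theorem exists_rightMode (n : ℕ) : ∃ u : H1Right,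
    H1Right.val u =ᵐ[unitMeasure]
      (fun x => √2 / (((n : ℝ) + 1 / 2) * π) * cos (((n : ℝ) + 1 / 2) * π * x)) ∧
    H1Right.der u =ᵐ[unitMeasure] (fun x => -√2 * sin (((n : ℝ) + 1 / 2) * π * x)) := by
  have hα : ((n : ℝ) + 1 / 2) * π ≠ 0 := by positivity
  refine H1Right.exists_of_hasDerivAt (fun x => ?_) (by fun_prop) ?_
  · refine (hasDerivAt_cos_mul _ _ x).congr_deriv ?_
    field_simp
  · have : ((n : ℝ) + 1 / 2) * π * 1 = n * π + π / 2 := by ring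
    rw [this, cos_add_pi_div_two, sin_nat_mul_pi]
    simp

theorem exists_mode (m : ℕ) : ∃ v : H1,
    H1.val v =ᵐ[unitMeasure]
      (fun x => mu m / √(1 + (m : ℝ) ^ 2 * π ^ 2) * cos ((m : ℝ) * π * x)) ∧
    H1.der v =ᵐ[unitMeasure] (fun x =>
      -(mu m / √(1 + (m : ℝ) ^ 2 * π ^ 2) * (m * π)) * sin ((m : ℝ) * π * x)) :=
  H1.exists_of_hasDerivAt (fun x => hasDerivAt_cos_mul _ _ x) (by fun_prop)

/-- The orthonormal basis `√2 cos((n+1/2)πx) / ((n+1/2)π)` of `H¹₍₁₎(0,1)`. -/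
noncomputable def rightMode (n : ℕ) : H1Right := (exists_rightMode n).choose

theorem rightMode_val (n : ℕ) : H1Right.val (rightMode n) =ᵐ[unitMeasure]
    (fun x => √2 / (((n : ℝ) + 1 / 2) * π) * cos (((n : ℝ) + 1 / 2) * π * x)) :=
  (exists_rightMode n).choose_spec.1

theorem rightMode_der (n : ℕ) : H1Right.der (rightMode n) =ᵐ[unitMeasure]
    (fun x => -√2 * sin (((n : ℝ) + 1 / 2) * π * x)) :=
  (exists_rightMode n).choose_spec.2

/-- The orthonormal basis `μₘ cos(mπx) / √(1+m²π²)` of `H¹(0,1)`. -/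
noncomputable def mode (m : ℕ) : H1 := (exists_mode m).choose

theorem mode_val (m : ℕ) : H1.val (mode m) =ᵐ[unitMeasure]
    (fun x => mu m / √(1 + (m : ℝ) ^ 2 * π ^ 2) * cos ((m : ℝ) * π * x)) :=
  (exists_mode m).choose_spec.1

theorem mode_der (m : ℕ) : H1.der (mode m) =ᵐ[unitMeasure]
    (fun x => -(mu m / √(1 + (m : ℝ) ^ 2 * π ^ 2) * (m * π)) * sin ((m : ℝ) * π * x)) :=
  (exists_mode m).choose_spec.2

theorem orthonormal_rightMode : Orthonormal ℝ rightMode := by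
  rw [orthonormal_iff_ite]
  intro n k
  rw [H1Right.inner_def, L2.real_inner_eq_of_ae (rightMode_der n) (rightMode_der k)]
  have e : ∀ A B : ℝ, -√2 * A * (-√2 * B) = 2 * (A * B) := fun A B => by
    linear_combination (A * B) * (mul_self_sqrt (zero_le_two (α := ℝ)))
  simp only [e]
  rw [intervalIntegral.integral_const_mul, integral_sin_mul_sin _ _ (n - k) (n + k + 1)
    (by push_cast; ring) (by push_cast; ring)]
  have h1 : (n : ℤ) + k + 1 ≠ 0 := by positivity
  have h2 : (n : ℤ) - k = 0 ↔ n = k := by omega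
  simp only [h1, h2, if_false]
  split_ifs <;> norm_num

theorem orthonormal_mode : Orthonormal ℝ mode := by
  rw [orthonormal_iff_ite]
  intro m k
  rw [H1.inner_def, L2.real_inner_eq_of_ae (mode_val m) (mode_val k),
    L2.real_inner_eq_of_ae (mode_der m) (mode_der k)]
  simp only [mul_mul_mul_comm (mu m / _) (cos _), mul_mul_mul_comm (-(mu m / _ * _)) (sin _)]
  rw [intervalIntegral.integral_const_mul, intervalIntegral.integral_const_mul,
    integral_sin_mul_sin _ _ (m - k) (m + k) (by push_cast; ring) (by push_cast; ring),
    integral_cos_mul_cos _ _ (m - k) (m + k) (by push_cast; ring) (by push_cast; ring)]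
  have h2 : (m : ℤ) - k = 0 ↔ m = k := by omega
  have h3 : (m : ℤ) + k = 0 ↔ m = 0 ∧ k = 0 := by omega
  simp only [h2, h3]
  rcases eq_or_ne m k with rfl | hmk
  · rcases eq_or_ne m 0 with rfl | hm
    · simp [mu]
    · have hs : √(1 + (m : ℝ) ^ 2 * π ^ 2) ^ 2 = 1 + (m : ℝ) ^ 2 * π ^ 2 :=
        sq_sqrt (by positivity)
      have h0 : √(1 + (m : ℝ) ^ 2 * π ^ 2) ≠ 0 := by positivity
      simp only [mu, hm, if_false, if_true, and_self]
      field_simp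
      rw [hs, sq_sqrt zero_le_two]
      ring
  · have h4 : ¬(m = 0 ∧ k = 0) := fun h => hmk (h.1.trans h.2.symm)
    simp [hmk, h4]

/-- The inner products are multiples of the half-integer sine moments of `f'`, so `f' = 0`, and
`f(1) = 0` does the rest. -/
theorem H1Right.eq_zero_of_inner_rightMode (f : H1Right)
    (h : ∀ n, inner ℝ (rightMode n) f = 0) : f = 0 := by
  refine f.eq_zero_of_der_eq_zero (Lp.eq_zero_iff_ae_eq_zero.2 ?_)
  refine ae_eq_zero_of_integral_sin (L2.integrable _) fun n => ?_
  have hn := h n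
  rw [H1Right.inner_def, L2.real_inner_eq_of_ae (rightMode_der n) (EventuallyEq.refl _ _),
    ← setIntegral_Ioo_eq] at hn
  simp only [mul_assoc (-√2)] at hn
  rw [integral_const_mul] at hn
  have h2 : -√2 ≠ 0 := by simp
  simpa only [mul_comm (H1Right.der f _)] using (mul_eq_zero.1 hn).resolve_left h2

theorem H1.eq_zero_of_inner_mode (g : H1) (h : ∀ m, inner ℝ (mode m) g = 0) : g = 0 := by
  refine Subtype.ext (Lp.eq_zero_iff_ae_eq_zero.2 ?_)
  change H1.val g =ᵐ[unitMeasure] 0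
  refine ae_eq_zero_of_integral_cos (L2.integrable _) fun m => ?_
  have hm := h m
  have hc : mu m / √(1 + (m : ℝ) ^ 2 * π ^ 2) ≠ 0 :=
    (div_pos (mu_pos m) (by positivity)).ne'
  rw [H1.inner_def, L2.real_inner_eq_of_ae (mode_val m) (EventuallyEq.refl _ _),
    L2.real_inner_eq_of_ae (mode_der m) (EventuallyEq.refl _ _), ← setIntegral_Ioo_eq,
    ← setIntegral_Ioo_eq] at hm
  simp only [mul_assoc (mu m / _), mul_assoc (-(mu m / _ * _))] at hm
  rw [integral_const_mul, integral_const_mul] at hm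
  have hp := g.integral_mul_deriv (hasDerivAt_sin_mul 1 (m * π)) (by fun_prop) (by simp)
    (by simp [sin_nat_mul_pi])
  simp only [one_mul, mul_left_comm _ ((m : ℝ) * π)] at hp
  rw [integral_const_mul] at hp
  simp only [mul_comm (H1.val g _), mul_comm (H1.der g _)] at hp ⊢
  -- Integrating by parts turns the derivative term into `(mπ)²` times the cosine moment of `g`, so
  -- orthogonality to `mode m` is the vanishing of that moment.
  have hz : mu m / √(1 + (m : ℝ) ^ 2 * π ^ 2) * ((1 + (m * π) ^ 2) *
      ∫ x in Ioo (0 : ℝ) 1, cos (m * π * x) * H1.val g x) = 0 := by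
    linear_combination hm + mu m / √(1 + (m : ℝ) ^ 2 * π ^ 2) * (m * π) * hp
  exact (mul_eq_zero.1 ((mul_eq_zero.1 hz).resolve_left hc)).resolve_left (by positivity)

/-- The product of the two trigonometric bases. -/
noncomputable def productMode : ℕ ⊕ ℕ → HSpace
  | Sum.inl n => WithLp.toLp 2 (rightMode n, 0)
  | Sum.inr m => WithLp.toLp 2 (0, mode m)

theorem orthonormal_productMode : Orthonormal ℝ productMode := by
  rw [orthonormal_iff_ite]
  have h1 := orthonormal_iff_ite.1 orthonormal_rightMode
  have h2 := orthonormal_iff_ite.1 orthonormal_mode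
  rintro (n | m) (n' | m') <;> simp [productMode, WithLp.prod_inner_apply, h1, h2]

theorem span_productMode_orthogonal :
    (Submodule.span ℝ (range productMode))ᗮ = ⊥ := by
  rw [Submodule.eq_bot_iff]
  intro x hx
  have h : ∀ i, inner ℝ (productMode i) x = 0 := fun i =>
    Submodule.mem_orthogonal _ _ |>.1 hx _ (Submodule.subset_span ⟨i, rfl⟩)
  have h1 : x.fst = 0 := H1Right.eq_zero_of_inner_rightMode _ fun n => by
    simpa [productMode, WithLp.prod_inner_apply] using h (Sum.inl n)
  have h2 : x.snd = 0 := H1.eq_zero_of_inner_mode _ fun m => by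
    simpa [productMode, WithLp.prod_inner_apply] using h (Sum.inr m)
  exact WithLp.ofLp_injective 2 (Prod.ext h1 h2)

/-- The trigonometric Hilbert basis of `H¹₍₁₎(0,1) × H¹(0,1)`. -/
noncomputable def productBasis : HilbertBasis (ℕ ⊕ ℕ) ℝ HSpace :=
  HilbertBasis.mkOfOrthogonalEqBot orthonormal_productMode span_productMode_orthogonal

theorem productBasis_apply (i : ℕ ⊕ ℕ) : productBasis i = productMode i := by
  simp [productBasis]

end TrigonometricBasis

/-! ### Uniform bounds on the perturbing functions -/

section Perturbations

open Real

/-- `Δ` only contains pairs of bounded size. -/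
theorem Delta.two_mul_add_le {a b : ℝ} {n m : ℕ} (h : (n, m) ∈ Delta a b) :
    2 * (m : ℝ) + 2 * n + 1 ≤ |b - a| := by
  have h1 : 4 * (b - a) = (2 * (m : ℝ) - (2 * n + 1)) * (2 * m + 2 * n + 1) * π ^ 2 := by
    rw [show 4 * (b - a) = _ from h]
    ring
  -- An odd integer is nonzero.
  have h2 : (1 : ℝ) ≤ |2 * (m : ℝ) - (2 * n + 1)| := by
    have : (1 : ℤ) ≤ |2 * (m : ℤ) - (2 * n + 1)| := Int.one_le_abs (by omega)
    exact_mod_cast this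
  have h3 := congrArg abs h1
  rw [abs_mul, abs_mul, abs_mul, abs_of_pos (by norm_num : (0 : ℝ) < 4),
    abs_of_pos (by positivity : (0 : ℝ) < 2 * (m : ℝ) + 2 * n + 1),
    abs_of_pos (by positivity : (0 : ℝ) < π ^ 2)] at h3
  have hpi : 4 ≤ π ^ 2 := by nlinarith [pi_gt_three]
  have h4 : 1 * (2 * (m : ℝ) + 2 * n + 1) * 4 ≤
      |2 * (m : ℝ) - (2 * n + 1)| * (2 * m + 2 * n + 1) * π ^ 2 := by gcongr
  linarith

/-- A square root of `c - α²`, for `α` large, is imaginary and close to `± i α`. -/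
theorem exists_eq_mul_I {r : ℂ} {c α : ℝ} (hr : r ^ 2 = ((c - α ^ 2 : ℝ) : ℂ))
    (hα : 1 + |c| ≤ α) : ∃ t : ℝ, r = t * Complex.I ∧ 1 ≤ |t| ∧ |(|t| - α)| ≤ 1 := by
  have hc := le_abs_self c
  rcases real_or_imaginary_of_sq hr with ⟨t, rfl⟩ | ⟨t, rfl⟩
  · have h : t ^ 2 = c - α ^ 2 := by exact_mod_cast hr
    nlinarith [sq_nonneg t, abs_nonneg c]
  · have h : -t ^ 2 = c - α ^ 2 := by
      rw [mul_pow, Complex.I_sq, mul_neg_one] at hr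
      exact_mod_cast hr
    refine ⟨t, rfl, (one_le_sq_iff_one_le_abs t).1 (by nlinarith [abs_nonneg c]), ?_⟩
    -- The second factor is at least `1 + |c|`, which forces the first to be at most one in absolute
    -- value.
    have ht : (|t| - α) * (|t| + α) = -c := by
      linear_combination sq_abs t - h
    have h2 := congrArg abs ht
    have hpos : 0 ≤ |t| + α := by linarith [abs_nonneg c, abs_nonneg t]
    rw [abs_mul, abs_neg, abs_of_nonneg hpos] at h2
    by_contra hlt
    nlinarith [abs_nonneg t, abs_nonneg c]

theorem half_le_abs_cos {δ : ℝ} (h : |δ| ≤ 1) : 1 / 2 ≤ |cos δ| := by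
  have h1 := one_sub_sq_div_two_le_cos (x := δ)
  have h2 := (sq_le_one_iff_abs_le_one δ).2 h
  exact (by linarith : 1 / 2 ≤ cos δ).trans (le_abs_self _)

theorem half_le_abs_cos_of_near {t : ℝ} {m : ℕ} (h : |(|t| - m * π)| ≤ 1) : 1 / 2 ≤ |cos t| := by
  have e : |t| = |t| - m * π + m * π := by ring
  rw [← cos_abs, e, cos_add_nat_mul_pi, abs_mul, abs_pow, abs_neg, abs_one, one_pow, one_mul]
  exact half_le_abs_cos h

theorem half_le_abs_sin_of_near {t : ℝ} {n : ℕ} (h : |(|t| - (n + 1 / 2) * π)| ≤ 1) :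
    1 / 2 ≤ |sin t| := by
  have e : |t| = |t| - (n + 1 / 2) * π + π / 2 + n * π := by ring
  have hs : |sin t| = |sin (|t|)| := by
    rcases abs_choice t with ht | ht <;> rw [ht]
    rw [sin_neg, abs_neg]
  rw [hs, e, sin_add_nat_mul_pi, abs_mul, abs_pow, abs_neg, abs_one, one_pow, one_mul,
    sin_add_pi_div_two]
  exact half_le_abs_cos h

theorem abs_mu_le (m : ℕ) : |mu m| ≤ √2 := by
  rw [abs_of_pos (mu_pos m), mu]
  split_ifs
  · exact one_le_sqrt.2 one_le_two
  · exact le_rfl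

theorem contDiff_re_comp {f : ℂ → ℂ} (hf : ContDiff ℂ 1 f) :
    ContDiff ℝ 1 fun x : ℝ => (f x).re :=
  Complex.reCLM.contDiff.comp ((hf.restrict_scalars ℝ).comp Complex.ofRealCLM.contDiff)

theorem contDiff_phi₂Fst (a b s : ℝ) (r : ℂ) (m : ℕ) : ContDiff ℝ 1 (phi₂Fst a b s r m) := by
  unfold phi₂Fst
  split_ifs
  · fun_prop
  · fun_prop
  · exact contDiff_re_comp (f := fun z => -((s * mu m : ℝ) : ℂ) / (r * Complex.cosh r) *
      Complex.sinh (r * (1 - z))) (by fun_prop)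

theorem phi₂Fst_one (a b s : ℝ) (r : ℂ) (m : ℕ) : phi₂Fst a b s r m 1 = 0 := by
  simp [phi₂Fst]

theorem contDiff_psi₁Snd (a b s : ℝ) (r : ℂ) (n : ℕ) : ContDiff ℝ 1 (psi₁Snd a b s r n) := by
  unfold psi₁Snd
  split_ifs
  · fun_prop
  · fun_prop
  · exact contDiff_re_comp (f := fun z => -((√2 * s : ℝ) : ℂ) / (r * Complex.sinh r) *
      Complex.cosh (r * (1 - z))) (by fun_prop)

theorem phi₂Fst_eq_sin {a b s t : ℝ} {m : ℕ} (h1 : m ∉ Delta₂ a b)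
    (h2 : b - a ≠ (m : ℝ) ^ 2 * π ^ 2) (x : ℝ) :
    phi₂Fst a b s (t * Complex.I) m x = -(s * mu m) / (t * cos t) * sin (t * (1 - x)) := by
  have e : (t : ℂ) * Complex.I * (1 - (x : ℂ)) = ((t * (1 - x) : ℝ) : ℂ) * Complex.I := by
    push_cast
    ring
  have : -((s * mu m : ℝ) : ℂ) / ((t : ℂ) * Complex.I * Real.cos t) *
      (Real.sin (t * (1 - x)) * Complex.I) =
      ((-(s * mu m) / (t * Real.cos t) * Real.sin (t * (1 - x)) : ℝ) : ℂ) := by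
    rw [mul_right_comm (t : ℂ), ← div_div, div_mul_eq_mul_div, mul_div_assoc,
      mul_div_cancel_right₀ _ Complex.I_ne_zero]
    push_cast
    rfl
  rw [phi₂Fst, dif_neg h1, if_neg h2, e, Complex.cosh_mul_I, Complex.sinh_mul_I,
    ← Complex.ofReal_cos, ← Complex.ofReal_sin, this, Complex.ofReal_re]

theorem psi₁Snd_eq_cos {a b s t : ℝ} {n : ℕ} (h1 : n ∉ Delta₁ a b) (x : ℝ) :
    psi₁Snd a b s (t * Complex.I) n x = (√2 * s) / (t * sin t) * cos (t * (1 - x)) := by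
  have e : (t : ℂ) * Complex.I * (1 - (x : ℂ)) = ((t * (1 - x) : ℝ) : ℂ) * Complex.I := by
    push_cast
    ring
  have : -((√2 * s : ℝ) : ℂ) / ((t : ℂ) * Complex.I * (Real.sin t * Complex.I)) *
      Real.cos (t * (1 - x)) =
      (((√2 * s) / (t * Real.sin t) * Real.cos (t * (1 - x)) : ℝ) : ℂ) := by
    rw [mul_mul_mul_comm, Complex.I_mul_I, mul_neg_one, neg_div_neg_eq]
    push_cast
    rfl
  rw [psi₁Snd, dif_neg h1, e, Complex.cosh_mul_I, Complex.sinh_mul_I,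
    ← Complex.ofReal_cos, ← Complex.ofReal_sin, this, Complex.ofReal_re]

/-- Differentiating cancels the `1/t`, leaving `s μₘ cos (t(1-x)) / cos t` with `|cos t| ≥ 1/2`.
Only the derivative matters for the norm of `H1Right`. -/
theorem abs_deriv_phi₂Fst_le {a b s : ℝ} {r : ℂ} {m : ℕ}
    (hr : r ^ 2 = ((lambda₂ b m - a : ℝ) : ℂ)) (hm : 1 + |b - a| ≤ m) (x : ℝ) :
    |deriv (phi₂Fst a b s r m) x| ≤ 2 * √2 * |s| := by
  have hmπ : (m : ℝ) ≤ m * π := le_mul_of_one_le_right (by positivity) (by linarith [pi_gt_three])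
  have hr' : r ^ 2 = ((b - a - (m * π) ^ 2 : ℝ) : ℂ) := by
    rw [hr, lambda₂]
    congr 1
    ring
  obtain ⟨t, rfl, ht1, ht⟩ := exists_eq_mul_I hr' (hm.trans hmπ)
  -- Such an `m` is beyond the bound on `Δ`, so both exceptional formulas are excluded.
  have h1 : m ∉ Delta₂ a b := by
    rintro ⟨n, hn⟩
    have := Delta.two_mul_add_le hn
    linarith [(Nat.cast_nonneg n : (0 : ℝ) ≤ n), (Nat.cast_nonneg m : (0 : ℝ) ≤ m)]
  have h2 : b - a ≠ (m : ℝ) ^ 2 * π ^ 2 := by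
    intro h
    nlinarith [le_abs_self (b - a), abs_nonneg (b - a)]
  have hcos := half_le_abs_cos_of_near ht
  have ht0 : t ≠ 0 := abs_pos.1 (by linarith)
  have hcos0 : cos t ≠ 0 := abs_pos.1 (by linarith)
  have hd : HasDerivAt (phi₂Fst a b s (t * Complex.I) m)
      (s * mu m / cos t * cos (t * (1 - x))) x := by
    rw [funext (phi₂Fst_eq_sin h1 h2)]
    have h := ((((hasDerivAt_id x).const_sub 1).const_mul t).sin).const_mul
      (-(s * mu m) / (t * cos t))
    refine h.congr_deriv ?_
    simp only [id]
    field_simp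
  rw [hd.deriv, abs_mul, abs_div, abs_mul]
  calc |s| * |mu m| / |cos t| * |cos (t * (1 - x))| ≤ |s| * √2 / (1 / 2) * 1 := by
        gcongr
        · exact abs_mu_le m
        · exact abs_cos_le_one _
    _ = 2 * √2 * |s| := by ring

/-- As for `φ`, with `sin t` as denominator; the function itself is bounded too, through `|t| ≥ 1`,
because the norm of `H1` includes it. -/
theorem abs_psi₁Snd_le {a b s : ℝ} {r : ℂ} {n : ℕ}
    (hr : r ^ 2 = ((lambda₁ a n - b : ℝ) : ℂ)) (hn : 1 + |b - a| ≤ n) (x : ℝ) :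
    |psi₁Snd a b s r n x| ≤ 2 * √2 * |s| ∧ |deriv (psi₁Snd a b s r n) x| ≤ 2 * √2 * |s| := by
  have hnπ : (n : ℝ) ≤ (n + 1 / 2) * π := by
    nlinarith [pi_gt_three, (Nat.cast_nonneg n : (0 : ℝ) ≤ n)]
  have hr' : r ^ 2 = ((a - b - ((n + 1 / 2) * π) ^ 2 : ℝ) : ℂ) := by
    rw [hr, lambda₁]
    congr 1
    ring
  obtain ⟨t, rfl, ht1, ht⟩ := exists_eq_mul_I hr' ((abs_sub_comm b a ▸ hn).trans hnπ)
  have h1 : n ∉ Delta₁ a b := by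
    rintro ⟨m, hm⟩
    have := Delta.two_mul_add_le hm
    linarith [(Nat.cast_nonneg n : (0 : ℝ) ≤ n), (Nat.cast_nonneg m : (0 : ℝ) ≤ m)]
  have hsin := half_le_abs_sin_of_near ht
  have ht0 : t ≠ 0 := abs_pos.1 (by linarith)
  have hsin0 : sin t ≠ 0 := abs_pos.1 (by linarith)
  have hd : HasDerivAt (psi₁Snd a b s (t * Complex.I) n)
      (√2 * s / sin t * sin (t * (1 - x))) x := by
    rw [funext (psi₁Snd_eq_cos h1)]
    have h := ((((hasDerivAt_id x).const_sub 1).const_mul t).cos).const_mul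
      ((√2 * s) / (t * sin t))
    refine h.congr_deriv ?_
    simp only [id]
    field_simp
  constructor
  · rw [psi₁Snd_eq_cos h1, abs_mul, abs_div, abs_mul, abs_mul, abs_of_nonneg (sqrt_nonneg 2)]
    calc √2 * |s| / (|t| * |sin t|) * |cos (t * (1 - x))| ≤ √2 * |s| / (1 * (1 / 2)) * 1 := by
          gcongr
          exact abs_cos_le_one _
      _ = 2 * √2 * |s| := by ring
  · rw [hd.deriv, abs_mul, abs_div, abs_mul, abs_of_nonneg (sqrt_nonneg 2)]
    calc √2 * |s| / |sin t| * |sin (t * (1 - x))| ≤ √2 * |s| / (1 / 2) * 1 := by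
          gcongr
          exact abs_sin_le_one _
      _ = 2 * √2 * |s| := by ring

theorem exists_h1Right_phi₂Fst (a b s : ℝ) (r : ℕ → ℂ)
    (hr : ∀ m, r m ^ 2 = ((lambda₂ b m - a : ℝ) : ℂ)) :
    ∃ f : ℕ → H1Right, (∀ m, H1Right.val (f m) =ᵐ[unitMeasure] phi₂Fst a b s (r m) m) ∧
      ∃ C : ℝ, ∀ᶠ m in atTop, ‖f m‖ ^ 2 ≤ C := by
  choose f hf hf' using fun m => H1Right.exists_of_hasDerivAt
    (fun x => ((contDiff_phi₂Fst a b s (r m) m).differentiable one_ne_zero x).hasDerivAt)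
    ((contDiff_phi₂Fst a b s (r m) m).continuous_deriv le_rfl) (phi₂Fst_one a b s (r m) m)
  refine ⟨f, hf, (2 * √2 * |s|) ^ 2, ?_⟩
  filter_upwards [tendsto_natCast_atTop_atTop.eventually_ge_atTop (1 + |b - a|)] with m hm
  rw [H1Right.norm_sq]
  exact L2.norm_sq_le (hf' m) fun x _ => abs_deriv_phi₂Fst_le (hr m) hm x

theorem exists_h1_psi₁Snd (a b s : ℝ) (r : ℕ → ℂ)
    (hr : ∀ n, r n ^ 2 = ((lambda₁ a n - b : ℝ) : ℂ)) :
    ∃ g : ℕ → H1, (∀ n, H1.val (g n) =ᵐ[unitMeasure] psi₁Snd a b s (r n) n) ∧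
      ∃ C : ℝ, ∀ᶠ n in atTop, ‖g n‖ ^ 2 ≤ C := by
  choose g hg hg' using fun n => H1.exists_of_hasDerivAt
    (fun x => ((contDiff_psi₁Snd a b s (r n) n).differentiable one_ne_zero x).hasDerivAt)
    ((contDiff_psi₁Snd a b s (r n) n).continuous_deriv le_rfl)
  refine ⟨g, hg, (2 * √2 * |s|) ^ 2 + (2 * √2 * |s|) ^ 2, ?_⟩
  filter_upwards [tendsto_natCast_atTop_atTop.eventually_ge_atTop (1 + |b - a|)] with n hn
  rw [H1.norm_sq]
  exact add_le_add (L2.norm_sq_le (hg n) fun x _ => (abs_psi₁Snd_le (hr n) hn x).1)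
    (L2.norm_sq_le (hg' n) fun x _ => (abs_psi₁Snd_le (hr n) hn x).2)

/-- Comparison with `∑ C / m²`; finitely many terms are unrestricted. -/
theorem summable_norm_sq_smul {E : Type*} [NormedAddCommGroup E] [NormedSpace ℝ E] {v : ℕ → E}
    {k : ℕ → ℝ} {C : ℝ} (hv : ∀ᶠ m in atTop, ‖v m‖ ^ 2 ≤ C)
    (hk : ∀ m ≠ 0, k m ^ 2 ≤ 1 / (m : ℝ) ^ 2) : Summable fun m => ‖k m • v m‖ ^ 2 := by
  refine Summable.of_norm_bounded_eventually_nat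
    ((Real.summable_one_div_nat_pow.2 one_lt_two).mul_right C) ?_
  filter_upwards [hv, eventually_ne_atTop 0] with m h1 h2
  rw [norm_pow, norm_norm, norm_smul, mul_pow, norm_eq_abs, sq_abs]
  gcongr
  exact hk m h2

end Perturbations

/-! ### The two Riesz bases -/

section RieszBases

open Real

theorem val_productBasis_inl (n : ℕ) :
    H1Right.val (productBasis (Sum.inl n)).fst =ᵐ[unitMeasure]
      (1 / (((n : ℝ) + 1 / 2) * π)) • (phi₁ n).1 := by
  rw [productBasis_apply]
  refine (rightMode_val n).trans (Eventually.of_forall fun x => ?_)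
  simp only [phi₁, Pi.smul_apply, smul_eq_mul]
  ring

theorem val_productBasis_inr (m : ℕ) :
    H1.val (productBasis (Sum.inr m)).snd =ᵐ[unitMeasure]
      (1 / √(1 + (m : ℝ) ^ 2 * π ^ 2)) • cosMode m := by
  rw [productBasis_apply]
  refine (mode_val m).trans (Eventually.of_forall fun x => ?_)
  simp only [Pi.smul_apply, smul_eq_mul, cosMode_eq]
  ring

theorem snd_productBasis_inl (n : ℕ) : (productBasis (Sum.inl n)).snd = 0 := by
  rw [productBasis_apply]
  rfl

theorem fst_productBasis_inr (m : ℕ) : (productBasis (Sum.inr m)).fst = 0 := by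
  rw [productBasis_apply]
  rfl

theorem coeFn_zero_ae (c : ℝ) : ((0 : L2) : ℝ → ℝ) =ᵐ[unitMeasure] c • fun _ => (0 : ℝ) := by
  filter_upwards [Lp.coeFn_zero ℝ 2 unitMeasure] with x hx
  simpa using hx

theorem coeFn_smul_ae {f : L2} {F : ℝ → ℝ} (h : f =ᵐ[unitMeasure] F) (c : ℝ) :
    (c • f : L2) =ᵐ[unitMeasure] c • F :=
  (Lp.coeFn_smul c f).trans (h.const_smul c)

theorem isRieszBasis_phi (a b s : ℝ) (r : ℕ → ℂ)
    (hr : ∀ m, r m ^ 2 = ((lambda₂ b m - a : ℝ) : ℂ)) :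
    ∃ Φ : ℕ ⊕ ℕ → HSpace,
      (∀ i, (Φ i).IsClassOf (rescaled phi₁ (fun m => phi₂ a b s (r m) m) i)) ∧
      IsRieszBasis Φ := by
  obtain ⟨f, hf, C, hC⟩ := exists_h1Right_phi₂Fst a b s r hr
  let w : ℕ ⊕ ℕ → HSpace := Sum.elim 0
    fun m => WithLp.toLp 2 ((1 / √(1 + (m : ℝ) ^ 2 * π ^ 2)) • f m, 0)
  refine ⟨fun i => productBasis i + w i, ?_, IsRieszBasis.of_add productBasis w ?_ ?_⟩
  · rintro (n | m)
    · refine ⟨?_, ?_⟩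
      · simpa [w, rescaled] using val_productBasis_inl n
      · simpa [w, rescaled, snd_productBasis_inl, phi₁] using
          coeFn_zero_ae (1 / (((n : ℝ) + 1 / 2) * π))
    · refine ⟨?_, ?_⟩
      · simpa [w, rescaled, fst_productBasis_inr, phi₂] using
          coeFn_smul_ae (hf m) (1 / √(1 + (m : ℝ) ^ 2 * π ^ 2))
      · simpa [w, rescaled, phi₂] using val_productBasis_inr m
  · refine Summable.sum _ ?_ ?_
    · simp [Function.comp_def, w]
    · refine (summable_norm_sq_smul (k := fun m : ℕ => 1 / √(1 + (m : ℝ) ^ 2 * π ^ 2)) hC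
        fun m hm => ?_).congr fun m => ?_
      · rw [div_pow, one_pow, sq_sqrt (by positivity)]
        gcongr
        have hπ : (1 : ℝ) ≤ π ^ 2 := one_le_pow₀ (by linarith [pi_gt_three])
        linarith [le_mul_of_one_le_right (sq_nonneg (m : ℝ)) hπ]
      · simp [w, WithLp.prod_norm_sq_eq_of_L2]
  -- In the one nontrivial case, `e i` lies in the second factor and `w j` in the first.
  · rintro (n | m) (n' | m')
    · exact Or.inr rfl
    · exact Or.inr rfl
    · exact Or.inl (inner_zero_right _)
    · left
      simp [w, WithLp.prod_inner_apply, fst_productBasis_inr]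

theorem isRieszBasis_psi (a b s : ℝ) (r : ℕ → ℂ)
    (hr : ∀ n, r n ^ 2 = ((lambda₁ a n - b : ℝ) : ℂ)) :
    ∃ Ψ : ℕ ⊕ ℕ → HSpace,
      (∀ i, (Ψ i).IsClassOf (rescaled (fun n => psi₁ a b s (r n) n) psi₂ i)) ∧
      IsRieszBasis Ψ := by
  obtain ⟨g, hg, C, hC⟩ := exists_h1_psi₁Snd a b s r hr
  let w : ℕ ⊕ ℕ → HSpace := Sum.elim
    (fun n => WithLp.toLp 2 (0, (1 / (((n : ℝ) + 1 / 2) * π)) • g n)) 0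
  refine ⟨fun i => productBasis i + w i, ?_, IsRieszBasis.of_add productBasis w ?_ ?_⟩
  · rintro (n | m)
    · refine ⟨?_, ?_⟩
      · simpa [w, rescaled, psi₁, phi₁] using val_productBasis_inl n
      · simpa [w, rescaled, snd_productBasis_inl, psi₁] using
          coeFn_smul_ae (hg n) (1 / (((n : ℝ) + 1 / 2) * π))
    · refine ⟨?_, ?_⟩
      · simpa [w, rescaled, fst_productBasis_inr, psi₂] using
          coeFn_zero_ae (1 / √(1 + (m : ℝ) ^ 2 * π ^ 2))
      · simpa [w, rescaled, psi₂] using val_productBasis_inr m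
  · refine Summable.sum _ ?_ ?_
    · refine (summable_norm_sq_smul (k := fun n : ℕ => 1 / (((n : ℝ) + 1 / 2) * π)) hC
        fun n hn => ?_).congr fun n => ?_
      · rw [div_pow, one_pow]
        gcongr
        nlinarith [pi_gt_three, (Nat.cast_nonneg n : (0 : ℝ) ≤ n)]
      · simp [w, WithLp.prod_norm_sq_eq_of_L2]
    · simp [Function.comp_def, w]
  -- The factors have exchanged roles: here `e i` lies in the first and `w j` in the second.
  · rintro (n | m) (n' | m')
    · left
      simp [w, WithLp.prod_inner_apply, snd_productBasis_inl]
    · exact Or.inl (inner_zero_right _)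
    · exact Or.inr rfl
    · exact Or.inr rfl

end RieszBases

end HeatCascade

theorem mainTheorem8 (a b s : ℝ) (hs : s ≠ 0) (r r' : ℕ → ℂ)
    (hr : ∀ m, r m ^ 2 = ((HeatCascade.lambda₂ b m - a : ℝ) : ℂ))
    (hr' : ∀ n, r' n ^ 2 = ((HeatCascade.lambda₁ a n - b : ℝ) : ℂ)) :
    (∃ Φ : ℕ ⊕ ℕ → HeatCascade.HSpace,
      (∀ i, (Φ i).IsClassOf (HeatCascade.rescaled HeatCascade.phi₁
        (fun m => HeatCascade.phi₂ a b s (r m) m) i)) ∧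
      HeatCascade.IsRieszBasis Φ) ∧
    (∃ Ψ : ℕ ⊕ ℕ → HeatCascade.HSpace,
      (∀ i, (Ψ i).IsClassOf (HeatCascade.rescaled
        (fun n => HeatCascade.psi₁ a b s (r' n) n) HeatCascade.psi₂ i)) ∧
      HeatCascade.IsRieszBasis Ψ) :=
  ⟨HeatCascade.isRieszBasis_phi a b s r hr, HeatCascade.isRieszBasis_psi a b s r' hr'⟩
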